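/- Let $A$ be a (unital, associative) ring, let $\omega\in A$, and let $\sigma\colon A\to A$ be a ring automorphism such that $\omega a=\sigma(a)\omega$ for all $a\in A$ and $\sigma(\omega)=\omega$. Modules are left modules. For an $A$-module $M$ let ${}^\sigma M$ be the abelian group $M$ on which $a\in A$ acts as $\sigma(a)$; this gives a functor ${}^\sigma(-)$ on $A\text{-Mod}$, and multiplication by $\omega$ is a natural transformation $\mathrm{Id}\to{}^\sigma(-)$. Let $\mathbf F(A;\omega)$ be the category of module factorizations: its objects are quadruples $X=(X^0,X^1;d_X^0,d_X^1)$ of $A$-modules and $A$-linear maps $d_X^0\colon X^0\to X^1$, $d_X^1\colon X^1\to{}^\sigma X^0$ with $d_X^1\circ d_X^0=\omega_{X^0}$ and ${}^\sigma(d_X^0)\circ d_X^1=\omega_{X^1}$; its morphisms $X\to Y$ are pairs $(f^0,f^1)$ of $A$-linear maps with $d_Y^0f^0=f^1d_X^0$ and $d_Y^1f^1={}^\sigma(f^0)d_X^1$. For a ring $R$ let $R\text{-GProj}$ be the full subcategory of $R\text{-Mod}$ of Gorenstein projective modules (modules isomorphic to the cocycles $Z^1(P^\bullet)$ of an acyclic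 complex $P^\bullet$ of projective $R$-modules, indexed by $\mathbb Z$, such that $\mathrm{Hom}_R(P^\bullet,Q)$ is acyclic for every projective $R$-module $Q$); its conflations are the short exact sequences of $R$-modules with Gorenstein projective terms. Let $\mathbf{GF}(A;\omega)=\mathbf F(A\text{-GProj};\omega)$ be the category of factorizations with Gorenstein projective components $X^0,X^1$, with the componentwise short exact sequences as conflations, and let $\mathbf{GF}^0(A;\omega)$ be its full subcategory of those $X$ for which $X^1$ is a projective object of the exact category $A\text{-GProj}$. For an idempotent $e\in R$ let $R\text{-GProj}^{e}$ be the full subcategory of those $G\in R\text{-GProj}$ for which the $eRe$-module $eG$ is projective. Both subcategories carry the inherited conflations. The idempotent $e$ is called GP-compatible if the left $eRe$-module $eR$ is projective and, for every Gorenstein projective $R$-module $G$, the $eRe$-module $eG$ is Gorenstein projective. Let $\Gamma=M_2(A;\omega,\sigma)$ be the twisted matrix ring: the additive group $M_2(A)$ with the multiplication $$\begin{pmatrix}a_{11}&a_{12}\\a_{21}&a_{22}\end{pmatrix}\begin{pmatrix}b_{11}&b_{12}\\b_{21}&b_{22}\end{pmatrix}=\begin{pmatrix}a_{11}b_{11}+a_{12}b_{21}\omega&a_{11}b_{12}+a_{12}b_{22}\\a_{21}\sigma(b_{11})+a_{22}b_{21}&a_{21}\omega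 b_{12}+a_{22}b_{22}\end{pmatrix},$$ and let $e_{11}=\begin{pmatrix}1&0\\0&0\end{pmatrix}\in\Gamma$. Then there is an equivalence of categories $\mathbf F(A;\omega)\simeq\Gamma\text{-Mod}$, which restricts to two equivalences of exact categories (equivalences such that both the functor and its quasi-inverse are additive and send conflations to conflations) $$\mathbf{GF}(A;\omega)\simeq\Gamma\text{-GProj}\quad\text{and}\quad\mathbf{GF}^0(A;\omega)\simeq\Gamma\text{-GProj}^{e_{11}}.$$ Moreover, the idempotent $e_{11}$ of $\Gamma$ is GP-compatible. -/

import Mathlib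

open CategoryTheory

universe u v

/-! ### Factorizations in a category -/

section Factorizations

/-- An `ω`-factorization `(X⁰, X¹; d⁰, d¹)` in `C`, for an endofunctor `T` of `C` and a natural
transformation `ω : Id ⟶ T`. -/
structure Factorization {C : Type u} [Category.{v} C] (T : C ⥤ C) (ω : 𝟭 C ⟶ T) where
  obj₀ : C
  obj₁ : C
  d₀ : obj₀ ⟶ obj₁
  d₁ : obj₁ ⟶ T.obj obj₀
  d₀_d₁ : d₀ ≫ d₁ = ω.app obj₀
  d₁_d₀ : d₁ ≫ T.map d₀ = ω.app obj₁

namespace Factorization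

variable {C : Type u} [Category.{v} C] {T : C ⥤ C} {ω : 𝟭 C ⟶ T}

/-- Morphisms of `ω`-factorizations. -/
@[ext]
structure Hom (X Y : Factorization T ω) where
  f₀ : X.obj₀ ⟶ Y.obj₀
  f₁ : X.obj₁ ⟶ Y.obj₁
  comm₀ : f₀ ≫ Y.d₀ = X.d₀ ≫ f₁
  comm₁ : f₁ ≫ Y.d₁ = X.d₁ ≫ T.map f₀

/-- The category `F(C; ω)` of `ω`-factorizations. -/
instance : Category.{v} (Factorization T ω) where
  Hom X Y := Hom X Y
  id X := ⟨𝟙 _, 𝟙 _, by simp, by simp⟩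
  comp f g := ⟨f.f₀ ≫ g.f₀, f.f₁ ≫ g.f₁,
    by rw [Category.assoc, g.comm₀, ← Category.assoc, f.comm₀, Category.assoc],
    by rw [Category.assoc, g.comm₁, ← Category.assoc, f.comm₁, Category.assoc, T.map_comp]⟩
  id_comp f := by ext <;> simp
  comp_id f := by ext <;> simp
  assoc f g h := by ext <;> simp

@[ext]
theorem hom_ext {X Y : Factorization T ω} {f g : X ⟶ Y} (h₀ : f.f₀ = g.f₀) (h₁ : f.f₁ = g.f₁) :
    f = g :=
  Hom.ext h₀ h₁

@[simp] theorem id_f₀ (X : Factorization T ω) : Hom.f₀ (𝟙 X) = 𝟙 X.obj₀ := rfl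
@[simp] theorem id_f₁ (X : Factorization T ω) : Hom.f₁ (𝟙 X) = 𝟙 X.obj₁ := rfl
@[simp] theorem comp_f₀ {X Y Z : Factorization T ω} (f : X ⟶ Y) (g : Y ⟶ Z) :
    (f ≫ g).f₀ = f.f₀ ≫ g.f₀ := rfl
@[simp] theorem comp_f₁ {X Y Z : Factorization T ω} (f : X ⟶ Y) (g : Y ⟶ Z) :
    (f ≫ g).f₁ = f.f₁ ≫ g.f₁ := rfl

/-- The projection functor `X ↦ X⁰`. -/
@[simps]
def pr₀ (T : C ⥤ C) (ω : 𝟭 C ⟶ T) : Factorization T ω ⥤ C where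
  obj X := X.obj₀
  map f := f.f₀

/-- The projection functor `X ↦ X¹`. -/
@[simps]
def pr₁ (T : C ⥤ C) (ω : 𝟭 C ⟶ T) : Factorization T ω ⥤ C where
  obj X := X.obj₁
  map f := f.f₁

section Preadditive

variable [Preadditive C] [T.Additive]

instance (X Y : Factorization T ω) : Zero (X ⟶ Y) :=
  ⟨⟨0, 0, by simp, by simp⟩⟩

instance (X Y : Factorization T ω) : Add (X ⟶ Y) :=
  ⟨fun f g => ⟨f.f₀ + g.f₀, f.f₁ + g.f₁, by simp [f.comm₀, g.comm₀],
    by simp [f.comm₁, g.comm₁, T.map_add]⟩⟩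

instance (X Y : Factorization T ω) : Neg (X ⟶ Y) :=
  ⟨fun f => ⟨-f.f₀, -f.f₁, by simp [f.comm₀], by simp [f.comm₁, T.map_neg]⟩⟩

@[simp] theorem zero_f₀ (X Y : Factorization T ω) : Hom.f₀ (0 : X ⟶ Y) = 0 := rfl
@[simp] theorem zero_f₁ (X Y : Factorization T ω) : Hom.f₁ (0 : X ⟶ Y) = 0 := rfl
@[simp] theorem add_f₀ {X Y : Factorization T ω} (f g : X ⟶ Y) : (f + g).f₀ = f.f₀ + g.f₀ := rfl
@[simp] theorem add_f₁ {X Y : Factorization T ω} (f g : X ⟶ Y) : (f + g).f₁ = f.f₁ + g.f₁ := rfl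
@[simp] theorem neg_f₀ {X Y : Factorization T ω} (f : X ⟶ Y) : (-f).f₀ = -f.f₀ := rfl
@[simp] theorem neg_f₁ {X Y : Factorization T ω} (f : X ⟶ Y) : (-f).f₁ = -f.f₁ := rfl

instance (X Y : Factorization T ω) : AddCommGroup (X ⟶ Y) where
  add_assoc f g h := by ext <;> simp [add_assoc]
  zero_add f := by ext <;> simp
  add_zero f := by ext <;> simp
  add_comm f g := by ext <;> simp [add_comm]
  neg_add_cancel f := by ext <;> simp
  nsmul := nsmulRec
  zsmul := zsmulRec

instance : Preadditive (Factorization T ω) where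
  add_comp X Y Z f f' g := by ext <;> simp
  comp_add X Y Z f g g' := by ext <;> simp

instance : (pr₀ T ω).Additive where
instance : (pr₁ T ω).Additive where

end Preadditive

/-- An endofunctor preserving a full subcategory restricts to it. -/
abbrev restrictFunctor (P : ObjectProperty C) (T : C ⥤ C) (hT : ∀ X, P X → P (T.obj X)) :
    P.FullSubcategory ⥤ P.FullSubcategory :=
  P.lift (P.ι ⋙ T) fun X => hT _ X.property

/-- The restriction of `ω : Id ⟶ T` to a full subcategory preserved by `T`. -/
def restrictNatTrans (P : ObjectProperty C) {T : C ⥤ C} (ω : 𝟭 C ⟶ T)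
    (hT : ∀ X, P X → P (T.obj X)) :
    𝟭 P.FullSubcategory ⟶ restrictFunctor P T hT where
  app X := ObjectProperty.homMk (ω.app X.obj)
  naturality X Y f := by
    ext
    exact ω.naturality f.hom

/-- The inclusion `F(P; ω) ⥤ F(C; ω)` for a full subcategory `P` of `C` preserved by `T`. -/
def inclusion (P : ObjectProperty C) {T : C ⥤ C} (ω : 𝟭 C ⟶ T) (hT : ∀ X, P X → P (T.obj X)) :
    Factorization (restrictFunctor P T hT) (restrictNatTrans P ω hT) ⥤ Factorization T ω where
  obj X :=
    { obj₀ := X.obj₀.obj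
      obj₁ := X.obj₁.obj
      d₀ := X.d₀.hom
      d₁ := X.d₁.hom
      d₀_d₁ := congrArg InducedCategory.Hom.hom X.d₀_d₁
      d₁_d₀ := congrArg InducedCategory.Hom.hom X.d₁_d₀ }
  map f := ⟨f.f₀.hom, f.f₁.hom, congrArg InducedCategory.Hom.hom f.comm₀,
    congrArg InducedCategory.Hom.hom f.comm₁⟩

end Factorization

end Factorizations

/-! ### Exact structures, given by their classes of conflations -/

namespace ExactStr

variable {C : Type u} [Category.{v} C] [Preadditive C]

/-- The conflations of a full subcategory: the sequences in it that are conflations of the ambient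
category. -/
def restrict (P : ObjectProperty C) (E : ObjectProperty (ShortComplex C)) :
    ObjectProperty (ShortComplex P.FullSubcategory) :=
  fun S => E (S.map P.ι)

/-- The conflations of `F(C; ω)`: the sequences whose two components are conflations of `C`. -/
def factorization (T : C ⥤ C) [T.Additive] (ω : 𝟭 C ⟶ T) (E : ObjectProperty (ShortComplex C)) :
    ObjectProperty (ShortComplex (Factorization T ω)) :=
  fun S => E (S.map (Factorization.pr₀ T ω)) ∧ E (S.map (Factorization.pr₁ T ω))

/-- `X` is projective with respect to the class `E` of conflations: every morphism from `X` lifts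
along every deflation. -/
def IsProjective (E : ObjectProperty (ShortComplex C)) : ObjectProperty C :=
  fun X => ∀ S : ShortComplex C, E S → ∀ f : X ⟶ S.X₃, ∃ g : X ⟶ S.X₂, g ≫ S.g = f

/-- `F⁰(C; ω)`, as a full subcategory of `F(C; ω)`: the component `X¹` is projective in the exact
category `C`. -/
def factorizationZero (T : C ⥤ C) (ω : 𝟭 C ⟶ T) (E : ObjectProperty (ShortComplex C)) :
    ObjectProperty (Factorization T ω) :=
  fun X => IsProjective E X.obj₁

/-- An exact functor: it is additive and sends conflations to conflations. -/
def IsExactFunctor {D : Type*} [Category* D] [Preadditive D] (E : ObjectProperty (ShortComplex C))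
    (E' : ObjectProperty (ShortComplex D)) (F : C ⥤ D) : Prop :=
  ∃ _ : F.Additive, ∀ S : ShortComplex C, E S → E' (S.map F)

/-- An equivalence of exact categories: the functor and its quasi-inverse are exact. -/
def IsExactEquivalence {D : Type*} [Category* D] [Preadditive D]
    (E : ObjectProperty (ShortComplex C)) (E' : ObjectProperty (ShortComplex D)) (F : C ≌ D) :
    Prop :=
  IsExactFunctor E E' F.functor ∧ IsExactFunctor E' E F.inverse

/-- The canonical exact structure on `R-Mod`: the short exact sequences. -/
def modules (R : Type u) [Ring R] : ObjectProperty (ShortComplex (ModuleCat.{v} R)) :=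
  fun S => S.ShortExact

end ExactStr

/-! ### Gorenstein projective modules -/

section GorensteinProjective

/-- Totally acyclic complexes of projective modules. The last field is the acyclicity of the
complex `Hom(P, Q)` for every projective module `Q`. -/
structure IsTotallyAcyclic {R : Type u} [Ring R] (P : CochainComplex (ModuleCat.{v} R) ℤ) :
    Prop where
  projective : ∀ n, Module.Projective R (P.X n)
  acyclic : P.Acyclic
  hom_acyclic : ∀ Q : ModuleCat.{v} R, Module.Projective R Q →
    ∀ (n : ℤ) (f : P.X n ⟶ Q), P.d (n - 1) n ≫ f = 0 →
      ∃ g : P.X (n + 1) ⟶ Q, P.d n (n + 1) ≫ g = f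

/-- A Gorenstein projective module: it is isomorphic to the first cocycles `Z¹(P)` of a totally
acyclic complex `P` of projective modules. -/
def IsGorensteinProjective (R : Type u) [Ring R] (M : Type v) [AddCommGroup M] [Module R M] :
    Prop :=
  ∃ P : CochainComplex (ModuleCat.{v} R) ℤ, IsTotallyAcyclic P ∧
    Nonempty (M ≃ₗ[R] LinearMap.ker (P.d 1 2).hom)

/-- `R-GProj`, as a full subcategory of `R-Mod`. -/
def GProj (R : Type u) [Ring R] : ObjectProperty (ModuleCat.{v} R) :=
  fun M => IsGorensteinProjective R M

/-- The conflations of `R-GProj`. -/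
def GProj.conflations (R : Type u) [Ring R] :
    ObjectProperty (ShortComplex (GProj.{u, v} R).FullSubcategory) :=
  ExactStr.restrict (GProj R) (ExactStr.modules R)

end GorensteinProjective

/-! ### Idempotents and Schur functors -/

section Idempotents

variable {R : Type u} [Ring R] {e : R}

/-- The abelian group `eM = {e m | m ∈ M}` for an idempotent `e` of `R` and an `R`-module `M`. -/
def schur (_he : IsIdempotentElem e) (M : Type v) [AddCommGroup M] [Module R M] : AddSubgroup M :=
  (DistribSMul.toAddMonoidHom M e).range

theorem smul_eq_of_mem_schur (he : IsIdempotentElem e) {M : Type v} [AddCommGroup M] [Module R M]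
    {m : M} (hm : m ∈ schur he M) : e • m = m := by
  obtain ⟨x, rfl⟩ := hm
  change e • e • x = e • x
  rw [smul_smul, he.eq]

theorem mem_schur_of_smul_eq (he : IsIdempotentElem e) {M : Type v} [AddCommGroup M] [Module R M]
    {m : M} (hm : e • m = m) : m ∈ schur he M :=
  ⟨m, hm⟩

/-- `eM` is a module over `eRe` (the ring `he.Corner`, with unit `e`), by restricting the action
of `R` on `M`. -/
instance schur.module (he : IsIdempotentElem e) (M : Type v) [AddCommGroup M] [Module R M] :
    Module he.Corner (schur he M) where
  smul c m := ⟨c.1 • m.1, mem_schur_of_smul_eq he (by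
    rw [smul_smul, ((Subsemigroup.mem_corner_iff he).1 c.2).1])⟩
  one_smul m := Subtype.ext (smul_eq_of_mem_schur he m.2)
  mul_smul c d m := Subtype.ext (mul_smul c.1 d.1 m.1)
  smul_zero c := Subtype.ext (smul_zero c.1)
  smul_add c m n := Subtype.ext (smul_add c.1 m.1 n.1)
  add_smul c d m := Subtype.ext (add_smul c.1 d.1 m.1)
  zero_smul m := Subtype.ext (zero_smul R m.1)

/-- The idempotent `e` is GP-compatible: the left `eRe`-module `eR` is projective, and `eG` is a
Gorenstein projective `eRe`-module for each Gorenstein projective `R`-module `G`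
(modules are taken in `Type v`). -/
def IsGPCompatible (he : IsIdempotentElem e) : Prop :=
  Module.Projective he.Corner (schur he R) ∧
    ∀ G : ModuleCat.{v} R, IsGorensteinProjective R G →
      IsGorensteinProjective he.Corner (schur he G)

/-- `R-GProj^e`, as a full subcategory of `R-GProj`: those `G` for which the `eRe`-module `eG` is
projective. -/
def GProjIdem (he : IsIdempotentElem e) : ObjectProperty (GProj.{u, v} R).FullSubcategory :=
  fun G => Module.Projective he.Corner (schur he G.obj)

end Idempotents

/-! ### Module factorizations and the twisted matrix ring -/

/-- The standing assumption on `ω` and `σ`: `ω a = σ(a) ω` for all `a`, and `σ(ω) = ω`. -/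
structure IsNormalTwist {A : Type u} [Ring A] (ω : A) (σ : A ≃+* A) : Prop where
  mul_eq : ∀ a, ω * a = σ a * ω
  map_eq : σ ω = ω

/-- The underlying set of the twisted matrix ring `M₂(A; ω, σ)`. -/
@[ext]
structure TwistedMatrix {A : Type u} [Ring A] {ω : A} {σ : A ≃+* A} (h : IsNormalTwist ω σ) where
  a₁₁ : A
  a₁₂ : A
  a₂₁ : A
  a₂₂ : A

namespace TwistedMatrix

variable {A : Type u} [Ring A] {ω : A} {σ : A ≃+* A} {h : IsNormalTwist ω σ}

instance : Zero (TwistedMatrix h) := ⟨⟨0, 0, 0, 0⟩⟩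
instance : One (TwistedMatrix h) := ⟨⟨1, 0, 0, 1⟩⟩
instance : Add (TwistedMatrix h) :=
  ⟨fun a b => ⟨a.a₁₁ + b.a₁₁, a.a₁₂ + b.a₁₂, a.a₂₁ + b.a₂₁, a.a₂₂ + b.a₂₂⟩⟩
instance : Neg (TwistedMatrix h) := ⟨fun a => ⟨-a.a₁₁, -a.a₁₂, -a.a₂₁, -a.a₂₂⟩⟩
instance : Mul (TwistedMatrix h) :=
  ⟨fun a b =>
    ⟨a.a₁₁ * b.a₁₁ + a.a₁₂ * b.a₂₁ * ω, a.a₁₁ * b.a₁₂ + a.a₁₂ * b.a₂₂,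
      a.a₂₁ * σ b.a₁₁ + a.a₂₂ * b.a₂₁, a.a₂₁ * ω * b.a₁₂ + a.a₂₂ * b.a₂₂⟩⟩

theorem zero_def : (0 : TwistedMatrix h) = ⟨0, 0, 0, 0⟩ := rfl
theorem one_def : (1 : TwistedMatrix h) = ⟨1, 0, 0, 1⟩ := rfl
theorem add_def (a b : TwistedMatrix h) :
    a + b = ⟨a.a₁₁ + b.a₁₁, a.a₁₂ + b.a₁₂, a.a₂₁ + b.a₂₁, a.a₂₂ + b.a₂₂⟩ := rfl
theorem neg_def (a : TwistedMatrix h) : -a = ⟨-a.a₁₁, -a.a₁₂, -a.a₂₁, -a.a₂₂⟩ := rfl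
theorem mul_def (a b : TwistedMatrix h) :
    a * b = ⟨a.a₁₁ * b.a₁₁ + a.a₁₂ * b.a₂₁ * ω, a.a₁₁ * b.a₁₂ + a.a₁₂ * b.a₂₂,
      a.a₂₁ * σ b.a₁₁ + a.a₂₂ * b.a₂₁, a.a₂₁ * ω * b.a₁₂ + a.a₂₂ * b.a₂₂⟩ := rfl

/-- The twisted matrix ring `M₂(A; ω, σ)`. -/
instance : Ring (TwistedMatrix h) where
  add_assoc a b c := by simp [add_def, add_assoc]
  zero_add a := by simp [add_def, zero_def]
  add_zero a := by simp [add_def, zero_def]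
  add_comm a b := by simp [add_def, add_comm]
  neg_add_cancel a := by simp [add_def, neg_def, zero_def]
  zero_mul a := by simp [mul_def, zero_def]
  mul_zero a := by simp [mul_def, zero_def]
  one_mul a := by simp [mul_def, one_def]
  mul_one a := by simp [mul_def, one_def]
  left_distrib a b c := by
    ext <;> simp only [mul_def, add_def, mul_add, add_mul, map_add] <;> abel
  right_distrib a b c := by
    ext <;> simp only [mul_def, add_def, add_mul] <;> abel
  mul_assoc a b c := by
    ext <;> simp only [mul_def, mul_add, add_mul, map_add, map_mul, mul_assoc, h.mul_eq,
      h.map_eq] <;> abel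
  nsmul := nsmulRec
  zsmul := zsmulRec

/-- The idempotent `e₁₁` of `M₂(A; ω, σ)`. -/
def e₁₁ (h : IsNormalTwist ω σ) : TwistedMatrix h := ⟨1, 0, 0, 0⟩

theorem isIdempotentElem_e₁₁ (h : IsNormalTwist ω σ) : IsIdempotentElem (e₁₁ h) := by
  simp [IsIdempotentElem, e₁₁, mul_def]

end TwistedMatrix

section ModuleFactorizations

variable {A : Type u} [Ring A]

/-- The twisting endofunctor `M ↦ ^σ(M)` of `A-Mod`: the module `^σ(M)` is the abelian group `M`
on which `a` acts as `σ(a)`. -/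
noncomputable abbrev twist (σ : A ≃+* A) : ModuleCat.{v} A ⥤ ModuleCat.{v} A :=
  ModuleCat.restrictScalars.{v} (σ : A →+* A)

variable {ω : A} {σ : A ≃+* A}

/-- The natural transformation `Id ⟶ ^σ(-)`, `m ↦ ω m`. -/
noncomputable def omegaTrans (h : IsNormalTwist ω σ) : 𝟭 (ModuleCat.{v} A) ⟶ twist.{u, v} σ where
  app M := ModuleCat.ofHom (Y := (twist.{u, v} σ).obj M)
    { toFun := fun m => (show M from ω • (show M from m))
      map_add' := fun m n => smul_add ω (show M from m) (show M from n)
      map_smul' := fun a m => by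
        change ω • a • (show M from m) = σ a • ω • (show M from m)
        rw [smul_smul, smul_smul, h.mul_eq] }
  naturality M N f := by
    ext m
    exact (map_smul f.hom ω m).symm

/-- The category `F(A; ω)` of module factorizations. -/
abbrev ModFact (h : IsNormalTwist ω σ) : Type (max u (v + 1)) :=
  Factorization (twist.{u, v} σ) (omegaTrans.{u, v} h)

theorem projective_twist (σ : A ≃+* A) (M : ModuleCat.{v} A) (hM : Module.Projective A M) :
    Module.Projective A ((twist.{u, v} σ).obj M) := by
  have := RingHomInvPair.of_ringEquiv σ.symm
  have := RingHomInvPair.symm (σ.symm : A →+* A) (σ.symm.symm : A →+* A)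
  exact Module.Projective.of_equiv (σ := (σ.symm : A →+* A)) (M := M)
    { toFun := fun m => (show (twist.{u, v} σ).obj M from m)
      map_add' := fun _ _ => rfl
      map_smul' := fun a m => by
        have key : σ (σ.symm a) • m = a • m := by rw [σ.apply_symm_apply]
        exact key.symm
      invFun := fun m => (show M from m)
      left_inv := fun _ => rfl
      right_inv := fun _ => rfl }

/-- Twisting preserves Gorenstein projective modules. -/
theorem twist_mem_GProj (σ : A ≃+* A) (M : ModuleCat.{v} A) (hM : GProj A M) :
    GProj A ((twist.{u, v} σ).obj M) := by
  obtain ⟨P, hP, ⟨i⟩⟩ := hM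
  refine ⟨((twist.{u, v} σ).mapHomologicalComplex (ComplexShape.up ℤ)).obj P, ⟨?_, ?_, ?_⟩, ⟨?_⟩⟩
  · intro n
    exact projective_twist σ (P.X n) (hP.projective n)
  · intro n
    have key := (HomologicalComplex.exactAt_iff' P (n - 1) n (n + 1) (by simp) (by simp)).1
      (hP.acyclic n)
    rw [HomologicalComplex.exactAt_iff' _ (n - 1) n (n + 1) (by simp) (by simp)]
    rw [ShortComplex.moduleCat_exact_iff] at key ⊢
    exact key
  · intro Q hQ n f hf
    obtain ⟨g, hg⟩ := hP.hom_acyclic ((twist.{u, v} σ.symm).obj Q) (projective_twist σ.symm Q hQ) n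
      (ModuleCat.ofHom (Y := (twist.{u, v} σ.symm).obj Q)
        { toFun := fun x => (show Q from f.hom x)
          map_add' := fun x y => f.hom.map_add x y
          map_smul' := fun a x => by
            have := f.hom.map_smul (σ.symm a) x
            change f.hom (σ (σ.symm a) • (show P.X n from x)) = _ at this
            rw [σ.apply_symm_apply] at this
            exact this })
      (by
        ext x
        exact congrArg (fun k => k.hom x) hf)
    refine ⟨ModuleCat.ofHom
      (X := (((twist.{u, v} σ).mapHomologicalComplex (ComplexShape.up ℤ)).obj P).X (n + 1))
        { toFun := fun x => (show Q from g.hom x)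
          map_add' := fun x y => g.hom.map_add x y
          map_smul' := fun a x => by
            have := g.hom.map_smul (σ a) x
            change _ = σ.symm (σ a) • (show Q from g.hom x) at this
            rw [σ.symm_apply_apply] at this
            exact this }, ?_⟩
    ext x
    exact congrArg (fun k => k.hom x) hg
  · exact
      { toFun := fun m => i m
        map_add' := fun m n => i.map_add m n
        map_smul' := fun a m => i.map_smul (σ a) m
        invFun := fun m => i.symm m
        left_inv := fun m => i.left_inv m
        right_inv := fun m => i.right_inv m }

/-- The category `GF(A; ω) = F(A-GProj; ω)`. -/
abbrev GFact (h : IsNormalTwist ω σ) : Type (max u (v + 1)) :=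
  Factorization (Factorization.restrictFunctor (GProj.{u, v} A) (twist σ) (twist_mem_GProj σ))
    (Factorization.restrictNatTrans (GProj.{u, v} A) (omegaTrans h) (twist_mem_GProj σ))

/-- The inclusion `GF(A; ω) ⥤ F(A; ω)`. -/
noncomputable abbrev GFact.inclusion (h : IsNormalTwist ω σ) : GFact.{u, v} h ⥤ ModFact.{u, v} h :=
  Factorization.inclusion (GProj A) (omegaTrans h) (twist_mem_GProj σ)

instance (σ : A ≃+* A) : (Factorization.restrictFunctor (GProj.{u, v} A) (twist σ)
    (twist_mem_GProj σ)).Additive where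
  map_add := by
    intros
    rfl

/-- The conflations of `GF(A; ω)`. -/
def GFact.conflations (h : IsNormalTwist ω σ) : ObjectProperty (ShortComplex (GFact.{u, v} h)) :=
  ExactStr.factorization _ _ (GProj.conflations A)

/-- The category `GF⁰(A; ω) = F⁰(A-GProj; ω)`, as a full subcategory of `GF(A; ω)`. -/
def GFactZero (h : IsNormalTwist ω σ) : ObjectProperty (GFact.{u, v} h) :=
  ExactStr.factorizationZero _ _ (GProj.conflations A)

end ModuleFactorizations

-- A Γ-module M splits as e₁₁M ⊕ e₂₂M, and the off-diagonal matrix units become maps between the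
-- summands, one of them σ-semilinear, whose composites are multiplication by ω. With X¹ = e₁₁M and
-- X⁰ = e₂₂M this is a module factorization, so `totalFunctor` is an equivalence, and short
-- exactness is tested on components (`shortExact_total_iff`). The rest hinges on `gProj_total_iff`:
-- Gorenstein projectivity over Γ is also tested on components.
--
-- That statement is proved abstractly for a `FrobeniusPair`. The component functors are exact and
-- have exact adjoints given by the trivial factorizations (U, U; 1, ω) and (V, σV; ω, 1), hence
-- they preserve Gorenstein projectives. Conversely, suppose that the components of X are Gorenstein
-- projective. Embeddings of the components into projectives yield, by adjunction, a monomorphism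
-- from X into a projective sum T of two trivial factorizations. The components of its cokernel
-- agree with the chosen cosyzygies up to projective summands (`GProj.of_cosyzygy_comparison`), so
-- they are again Gorenstein projective; syzygies are dual. These sequences stay exact under Hom
-- into projectives (`FrobeniusPair.exists_extension`), and splicing them gives a totally acyclic
-- complex (`GProj.of_class`).
--
-- Finally A ≅ e₁₁Γe₁₁ and X¹ ≅ e₁₁M compatibly, and the projective objects of A-GProj are the
-- projective modules; this matches GF⁰ with GProj^{e₁₁} and yields GP-compatibility.

universe w

/-! ### Gorenstein projective modules as two-sided chains of syzygies -/

section Syzygies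

variable {R : Type u} [Ring R]

theorem ModuleCat.shortExact_mk_iff {X P Y : ModuleCat.{w} R} (i : X ⟶ P) (p : P ⟶ Y)
    (hw : i ≫ p = 0) :
    (ShortComplex.mk i p hw).ShortExact ↔ Function.Injective i ∧ Function.Surjective p ∧
      ∀ y, p y = 0 → ∃ x, i x = y := by
  constructor
  · intro hS
    exact ⟨hS.moduleCat_injective_f, hS.moduleCat_surjective_g,
      (ShortComplex.moduleCat_exact_iff _).1 hS.exact⟩
  · rintro ⟨hi, hp, he⟩
    have := (ModuleCat.mono_iff_injective i).2 hi
    have := (ModuleCat.epi_iff_surjective p).2 hp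
    exact .mk ((ShortComplex.moduleCat_exact_iff _).2 he)

/-- There is a short exact sequence `0 ⟶ X ⟶ P ⟶ Y ⟶ 0` with `P` projective, which stays exact
under `Hom(-, Q)` for every projective module `Q`. -/
def IsSyzygy (X Y : ModuleCat.{w} R) : Prop :=
  ∃ (P : ModuleCat.{w} R) (i : X ⟶ P) (p : P ⟶ Y) (hw : i ≫ p = 0),
    (ShortComplex.mk i p hw).ShortExact ∧ Projective P ∧
      ∀ (Q : ModuleCat.{w} R) [Projective Q] (f : X ⟶ Q), ∃ g, i ≫ g = f

theorem IsSyzygy.of_iso {X X' Y Y' : ModuleCat.{w} R} (hS : IsSyzygy X Y) (α : X ≅ X')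
    (β : Y ≅ Y') : IsSyzygy X' Y' := by
  obtain ⟨P, i, p, hw, hS, hP, hQ⟩ := hS
  refine ⟨P, α.inv ≫ i, p ≫ β.hom, by simp [reassoc_of% hw], ?_, hP, fun Q _ f => ?_⟩
  · refine ShortComplex.shortExact_of_iso
      (ShortComplex.isoMk (S₁ := ShortComplex.mk i p hw) α (Iso.refl _) β ?_ ?_) hS
    · simp
    · simp
  · obtain ⟨g, hg⟩ := hQ Q (α.hom ≫ f)
    exact ⟨g, by simp [hg]⟩

theorem IsSyzygy.prod {X X' Y Y' : ModuleCat.{w} R} (hS : IsSyzygy X Y) (hS' : IsSyzygy X' Y')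
    [Small.{w} R] : IsSyzygy (ModuleCat.of R (X × X')) (ModuleCat.of R (Y × Y')) := by
  obtain ⟨P, i, p, hw, hS, hP, hQ⟩ := hS
  obtain ⟨P', i', p', hw', hS', hP', hQ'⟩ := hS'
  have e := ((ModuleCat.shortExact_mk_iff _ _ _).1 hS)
  have e' := ((ModuleCat.shortExact_mk_iff _ _ _).1 hS')
  have z : ∀ x, p (i x) = 0 := fun x => congrArg (fun k => k.hom x) hw
  have z' : ∀ x, p' (i' x) = 0 := fun x => congrArg (fun k => k.hom x) hw'
  refine ⟨ModuleCat.of R (P × P'), ModuleCat.ofHom (i.hom.prodMap i'.hom),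
    ModuleCat.ofHom (p.hom.prodMap p'.hom), ?_, ?_, ?_, fun Q _ f => ?_⟩
  · apply ModuleCat.hom_ext
    exact LinearMap.ext fun x : X × X' => Prod.ext (z x.1) (z' x.2)
  · refine (ModuleCat.shortExact_mk_iff _ _ _).2
      ⟨e.1.prodMap e'.1, e.2.1.prodMap e'.2.1, fun y hy => ?_⟩
    obtain ⟨x, hx⟩ := e.2.2 y.1 (congrArg Prod.fst hy)
    obtain ⟨x', hx'⟩ := e'.2.2 y.2 (congrArg Prod.snd hy)
    exact ⟨(x, x'), Prod.ext hx hx'⟩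
  · have := ModuleCat.projective_of_module_projective P
    have := ModuleCat.projective_of_module_projective P'
    exact (IsProjective.iff_projective _).1 inferInstance
  · obtain ⟨g, hg⟩ := hQ Q (ModuleCat.ofHom (LinearMap.inl R X X') ≫ f)
    obtain ⟨g', hg'⟩ := hQ' Q (ModuleCat.ofHom (LinearMap.inr R X X') ≫ f)
    refine ⟨ModuleCat.ofHom (g.hom.coprod g'.hom), ?_⟩
    refine ModuleCat.hom_ext (LinearMap.ext fun x : X × X' => ?_)
    have h₁ : g (i x.1) = f (x.1, 0) := congrArg (fun k => k.hom x.1) hg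
    have h₂ : g' (i' x.2) = f (0, x.2) := congrArg (fun k => k.hom x.2) hg'
    change g (i x.1) + g' (i' x.2) = f x
    rw [h₁, h₂, ← map_add]
    simp

/-- Iterate a chosen successor in nonnegative degrees and a chosen predecessor in negative ones. -/
theorem exists_int_chain {α : Type*} (r : α → α → Prop) (hnext : ∀ a, ∃ b, r a b)
    (hprev : ∀ b, ∃ a, r a b) (a : α) : ∃ g : ℤ → α, (∀ n, r (g n) (g (n + 1))) ∧ g 0 = a := by
  choose s hs using hnext
  choose t ht using hprev
  refine ⟨fun n => match n with
    | Int.ofNat k => s^[k] a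
    -- `Int.negSucc k` is `-(k + 1)`, hence `k + 1` backward steps.
    | Int.negSucc k => t^[k + 1] a, fun n => ?_, rfl⟩
  match n with
  | Int.ofNat k =>
    change r (s^[k] a) (s^[k + 1] a)
    rw [Function.iterate_succ_apply']
    exact hs _
  | Int.negSucc 0 => exact ht a
  | Int.negSucc (k + 1) =>
    have : Int.negSucc (k + 1) + 1 = Int.negSucc k := by omega
    rw [this]
    change r (t^[k + 1 + 1] a) (t^[k + 1] a)
    rw [Function.iterate_succ_apply' t (k + 1)]
    exact ht _

/-- Splicing a sequence of syzygies gives a totally acyclic complex. -/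
theorem GProj.of_chain [Small.{w} R] {g : ℤ → ModuleCat.{w} R}
    (hg : ∀ n, IsSyzygy (g n) (g (n + 1))) (n : ℤ) : GProj R (g n) := by
  -- Gorenstein projectives are defined through cocycles in degree 1, so the chain is shifted by `n
  -- - 1`.
  wlog hn : n = 1 generalizing g n
  · have key : GProj R (g (1 + (n - 1))) :=
      this (g := fun m => g (m + (n - 1))) (fun m => by
        have := hg (m + (n - 1))
        rwa [show m + (n - 1) + 1 = m + 1 + (n - 1) by ring] at this) 1 rfl
    rwa [show 1 + (n - 1) = n by ring] at key
  subst hn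
  choose P i p hw hS hP hQ using hg
  have e := fun n => (ModuleCat.shortExact_mk_iff _ _ _).1 (hS n)
  have z : ∀ n x, p n (i n x) = 0 := fun n x => congrArg (fun k => k.hom x) (hw n)
  -- The differential factors as `P n ⟶ g (n + 1) ⟶ P (n + 1)`, so `g n` is the kernel of the
  -- differential leaving degree `n`.
  let K : CochainComplex (ModuleCat.{w} R) ℤ := CochainComplex.of P (fun n => p n ≫ i (n + 1))
    (fun n => by simp [reassoc_of% hw])
  have hd : ∀ n, K.d n (n + 1) = p n ≫ i (n + 1) := fun n => by
    simp [K]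
  refine ⟨K, ⟨fun n => ?_, fun n => ?_, fun Q hQ' n f hf => ?_⟩, ⟨?_⟩⟩
  · have := hP n
    exact ModuleCat.projective_of_module_projective (P n)
  · obtain ⟨n, rfl⟩ : ∃ m, n = m + 1 := ⟨n - 1, by ring⟩
    rw [HomologicalComplex.exactAt_iff' _ n (n + 1) (n + 1 + 1) (by simp) (by simp),
      ShortComplex.moduleCat_exact_iff]
    intro x hx
    change K.d (n + 1) (n + 1 + 1) x = 0 at hx
    rw [hd] at hx
    have hx' : p (n + 1) x = 0 := (e (n + 1 + 1)).1 (hx.trans (map_zero (i _).hom).symm)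
    obtain ⟨y, hy⟩ := (e (n + 1)).2.2 x hx'
    obtain ⟨x', rfl⟩ := (e n).2.1 y
    refine ⟨x', ?_⟩
    change K.d n (n + 1) x' = x
    rw [hd]
    exact hy
  -- A free predecessor index avoids terms `n + 1 - 1` in the types after substitution.
  · replace hf : ∀ m, m + 1 = n → K.d m n ≫ f = 0 := by
      intro m hm
      obtain rfl : m = n - 1 := by omega
      exact hf
    obtain ⟨n, rfl⟩ : ∃ m, n = m + 1 := ⟨n - 1, by ring⟩
    have hf' := hf n rfl
    rw [hd] at hf'
    have hpe : Epi (p n) := (hS n).epi_g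
    -- As `p n` is epi, `f` kills `g (n + 1)`; it then descends to `g (n + 1 + 1)` and extends along
    -- the next inclusion.
    have hif : i (n + 1) ≫ f = 0 := by
      rw [← cancel_epi (p n), ← Category.assoc, Limits.comp_zero]
      exact hf'
    have : Projective Q := (IsProjective.iff_projective Q).1 hQ'
    have hf₂ : ∃ k : g (n + 1 + 1) ⟶ Q, p (n + 1) ≫ k = f :=
      ⟨(hS (n + 1)).gIsCokernel.desc (Limits.CokernelCofork.ofπ f hif),
        (hS (n + 1)).gIsCokernel.fac (Limits.CokernelCofork.ofπ f hif) .one⟩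
    obtain ⟨k, rfl⟩ := hf₂
    obtain ⟨k', rfl⟩ := hQ _ Q k
    refine ⟨k', ?_⟩
    rw [hd, Category.assoc]
  · have hd' : K.d 1 2 = p 1 ≫ i 2 := hd 1
    refine LinearEquiv.ofBijective ((i 1).hom.codRestrict _ fun x => ?_) ⟨fun x y hxy => ?_, ?_⟩
    · rw [LinearMap.mem_ker, hd']
      change i 2 (p 1 (i 1 x)) = 0
      rw [z, map_zero]
    · exact (e 1).1 (congrArg Subtype.val hxy)
    · rintro ⟨x, hx⟩
      rw [LinearMap.mem_ker, hd'] at hx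
      obtain ⟨y, hy⟩ := (e 1).2.2 x ((e 2).1 (hx.trans (map_zero (i 2).hom).symm))
      exact ⟨y, Subtype.ext hy⟩

theorem GProj.of_iso {X Y : ModuleCat.{w} R} (hX : GProj R X) (α : X ≅ Y) : GProj R Y := by
  obtain ⟨P, hP, ⟨β⟩⟩ := hX
  exact ⟨P, hP, ⟨α.toLinearEquiv.symm.trans β⟩⟩

instance : (GProj.{u, w} R).IsClosedUnderIsomorphisms where
  of_iso α hX := hX.of_iso α

/-- The cocycles of a totally acyclic complex form the chain, indexed with a shift by one so that Z¹
sits at 0. -/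
theorem GProj.exists_chain [Small.{w} R] {X : ModuleCat.{w} R} (hX : GProj R X) :
    ∃ g : ℤ → ModuleCat.{w} R, (∀ n, IsSyzygy (g n) (g (n + 1))) ∧ Nonempty (g 0 ≅ X) := by
  obtain ⟨P, hP, ⟨α⟩⟩ := hX
  suffices h : ∀ n, IsSyzygy (ModuleCat.of R (LinearMap.ker (P.d n (n + 1)).hom))
      (ModuleCat.of R (LinearMap.ker (P.d (n + 1) (n + 1 + 1)).hom)) from
    ⟨fun n => ModuleCat.of R (LinearMap.ker (P.d (n + 1) (n + 1 + 1)).hom), fun n => h (n + 1),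
      ⟨α.symm.toModuleIso⟩⟩
  intro n
  have hdd : ∀ x, P.d (n + 1) (n + 1 + 1) (P.d n (n + 1) x) = 0 := fun x =>
    congrArg (fun k => k.hom x) (P.d_comp_d n (n + 1) (n + 1 + 1))
  have hex := (HomologicalComplex.exactAt_iff' P n (n + 1) (n + 1 + 1) (by simp) (by simp)).1
    (hP.acyclic (n + 1))
  rw [ShortComplex.moduleCat_exact_iff] at hex
  have hex' := (HomologicalComplex.exactAt_iff' P (n - 1) n (n + 1) (by simp) (by simp)).1
    (hP.acyclic n)
  rw [ShortComplex.moduleCat_exact_iff] at hex'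
  refine ⟨P.X n, ModuleCat.ofHom (Submodule.subtype _),
    ModuleCat.ofHom ((P.d n (n + 1)).hom.codRestrict _ hdd), ?_, ?_, ?_, fun Q _ f => ?_⟩
  · ext x
    exact x.2
  · refine (ModuleCat.shortExact_mk_iff _ _ _).2 ⟨Subtype.val_injective, fun y => ?_,
      fun y hy => ⟨⟨y, congrArg Subtype.val hy⟩, rfl⟩⟩
    obtain ⟨x, hx⟩ := hex y.1 y.2
    exact ⟨x, Subtype.ext hx⟩
  · have := hP.projective n
    infer_instance
  · have hQ : ∀ a b c (_ : a + 1 = b) (_ : b + 1 = c) (f : P.X b ⟶ Q), P.d a b ≫ f = 0 →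
        ∃ g : P.X c ⟶ Q, P.d b c ≫ g = f := by
      intro a b c hab hbc f hf
      obtain rfl : a = b - 1 := by omega
      subst hbc
      exact hP.hom_acyclic Q (ModuleCat.projective_of_module_projective Q) b f hf
    have hdd' : ∀ x, P.d n (n + 1) (P.d (n - 1) n x) = 0 := fun x =>
      congrArg (fun k => k.hom x) (P.d_comp_d (n - 1) n (n + 1))
    -- Pulled back to `P.X (n - 1)`, which surjects onto the cocycles in degree `n`, the map `f`
    -- kills the incoming differential. Hom-acyclicity then provides a map on `P.X n`, and the
    -- surjection is cancelled.
    obtain ⟨g, hg⟩ := hQ (n - 1 - 1) (n - 1) n (by ring) (by ring)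
      (ModuleCat.ofHom ((P.d (n - 1) n).hom.codRestrict (LinearMap.ker (P.d n (n + 1)).hom)
        fun x => hdd' x) ≫ f) (by
      rw [← Category.assoc]
      convert Limits.zero_comp
      ext x
      exact congrArg (fun k => k.hom x) (P.d_comp_d (n - 1 - 1) (n - 1) n))
    refine ⟨g, ?_⟩
    ext x
    obtain ⟨y, hy⟩ := hex' x.1 x.2
    have h₁ : g x.1 = _ := (congrArg g hy.symm).trans (congrArg (fun k => k.hom y) hg)
    refine h₁.trans (congrArg f (Subtype.ext hy))

/-- A class of modules in which every module is a syzygy and has a syzygy consists of Gorenstein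
projective modules. -/
theorem GProj.of_class [Small.{w} R] {P : ObjectProperty (ModuleCat.{w} R)}
    (hnext : ∀ X, P X → ∃ Y, P Y ∧ IsSyzygy X Y) (hprev : ∀ Y, P Y → ∃ X, P X ∧ IsSyzygy X Y)
    {X : ModuleCat.{w} R} (hX : P X) : GProj R X := by
  obtain ⟨g, hg, h₀⟩ := exists_int_chain
    (fun X Y : {X : ModuleCat.{w} R // P X} => IsSyzygy X.1 Y.1)
    (fun X => (hnext X.1 X.2).elim fun Y hY => ⟨⟨Y, hY.1⟩, hY.2⟩)
    (fun X => (hprev X.1 X.2).elim fun Y hY => ⟨⟨Y, hY.1⟩, hY.2⟩) ⟨X, hX⟩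
  have := GProj.of_chain (g := fun n => (g n).1) hg 0
  rwa [h₀] at this

variable [Small.{w} R]

theorem GProj.exists_cosyzygy {X : ModuleCat.{w} R} (hX : GProj R X) :
    ∃ Y, GProj R Y ∧ IsSyzygy X Y := by
  obtain ⟨g, hg, ⟨α⟩⟩ := hX.exists_chain
  exact ⟨g 1, GProj.of_chain hg 1, (hg 0).of_iso α (Iso.refl _)⟩

theorem GProj.exists_syzygy {Y : ModuleCat.{w} R} (hY : GProj R Y) :
    ∃ X, GProj R X ∧ IsSyzygy X Y := by
  obtain ⟨g, hg, ⟨α⟩⟩ := hY.exists_chain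
  exact ⟨g (-1), GProj.of_chain hg (-1), (hg (-1)).of_iso (Iso.refl _) α⟩

/-- The sequences 0 → X → X → 0 → 0 and 0 → 0 → Y → Y → 0 make the class of projectives satisfy
`GProj.of_class`. -/
theorem GProj.of_projective (X : ModuleCat.{w} R) [Projective X] : GProj R X := by
  have h₀ : Projective (ModuleCat.of R PUnit.{w + 1}) := (IsProjective.iff_projective _).1
    inferInstance
  refine GProj.of_class (P := fun X => Projective X) (fun X hX => ⟨ModuleCat.of R PUnit, h₀,
    X, 𝟙 X, 0, by simp, ?_, hX, fun Q _ f => ⟨f, by simp⟩⟩) (fun Y hY =>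
      ⟨ModuleCat.of R PUnit, h₀, Y, 0, 𝟙 Y, by simp, ?_, hY, fun Q _ f => ⟨0, ?_⟩⟩) ‹_›
  · exact (ModuleCat.shortExact_mk_iff _ _ _).2
      ⟨fun x y h => h, fun x => ⟨0, rfl⟩, fun y _ => ⟨y, rfl⟩⟩
  · exact (ModuleCat.shortExact_mk_iff _ _ _).2
      ⟨fun x y h => rfl, fun x => ⟨x, rfl⟩, fun y hy => ⟨0, hy.symm⟩⟩
  · ext x
    exact (map_zero f.hom).symm

theorem GProj.prod {X Y : ModuleCat.{w} R} (hX : GProj R X) (hY : GProj R Y) :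
    GProj R (ModuleCat.of R (X × Y)) := by
  obtain ⟨g, hg, ⟨α⟩⟩ := hX.exists_chain
  obtain ⟨g', hg', ⟨α'⟩⟩ := hY.exists_chain
  exact (GProj.of_chain (fun n => (hg n).prod (hg' n)) 0).of_iso
    (α.toLinearEquiv.prodCongr α'.toLinearEquiv).toModuleIso

/-- `Ext¹(G, Q) = 0` for `G` Gorenstein projective and `Q` projective. -/
theorem GProj.exists_extension {X E G Q : ModuleCat.{w} R} (hG : GProj R G) [Projective Q]
    {i : X ⟶ E} {p : E ⟶ G} (hw : i ≫ p = 0) (hS : (ShortComplex.mk i p hw).ShortExact)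
    (f : X ⟶ Q) : ∃ g : E ⟶ Q, i ≫ g = f := by
  obtain ⟨K, -, P, j, q, hjq, hS', hP, hQ⟩ := hG.exists_syzygy
  have : Epi p := hS.epi_g
  obtain ⟨hi, hp, he⟩ := (ModuleCat.shortExact_mk_iff _ _ _).1 hS
  obtain ⟨hj, hq, he'⟩ := (ModuleCat.shortExact_mk_iff _ _ _).1 hS'
  let l : P ⟶ E := Projective.factorThru q p
  have hl : l ≫ p = q := Projective.factorThru_comp q p
  have hlx : ∀ x, p (l x) = q x := fun x => congrArg (fun k => k.hom x) hl
  have hpi : ∀ x, p (i x) = 0 := fun x => congrArg (fun k => k.hom x) hw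
  have hqj : ∀ x, q (j x) = 0 := fun x => congrArg (fun k => k.hom x) hjq
  -- The map on kernels induced by the lift `l` of `q`.
  let κ : K ⟶ X := hS.fIsKernel.lift (Limits.KernelFork.ofι (j ≫ l) (by
    change (j ≫ l) ≫ p = 0
    rw [Category.assoc, hl, hjq]))
  have hκ : κ ≫ i = j ≫ l := hS.fIsKernel.fac (Limits.KernelFork.ofι (j ≫ l) _) .zero
  have hκx : ∀ x, i (κ x) = l (j x) := fun x => congrArg (fun k => k.hom x) hκ
  obtain ⟨m, hm⟩ := hQ Q (κ ≫ f)
  have hmx : ∀ x, m (j x) = f (κ x) := fun x => congrArg (fun k => k.hom x) hm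
  -- `E` is the pushout of `P` and `X` along `K`: the kernel of `s` consists of the pairs `(j k, -κ
  -- k)`, on which `t` vanishes, so `t` descends to the required extension.
  let s : P × X →ₗ[R] E := l.hom.coprod i.hom
  have hs : Function.Surjective s := by
    intro x
    obtain ⟨y, hy⟩ := hq (p x)
    obtain ⟨z, hz⟩ := he (x - l y) (by rw [map_sub, hlx, hy, sub_self])
    refine ⟨(y, z), ?_⟩
    change l y + i z = x
    rw [hz]
    abel
  let t : P × X →ₗ[R] Q := m.hom.coprod f.hom
  have hst : LinearMap.ker s ≤ LinearMap.ker t := by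
    rintro ⟨y, z⟩ (hyz : l y + i z = 0)
    change m y + f z = 0
    obtain ⟨k, rfl⟩ := he' y (by
      rw [← hlx, eq_neg_of_add_eq_zero_left hyz, map_neg, hpi, neg_zero])
    have : z = -κ k := hi (by rw [map_neg, hκx, eq_neg_of_add_eq_zero_right hyz])
    rw [hmx, this, map_neg, add_neg_cancel]
  refine ⟨ModuleCat.ofHom ((LinearMap.ker s).liftQ t hst ∘ₗ
    (s.quotKerEquivOfSurjective hs).symm.toLinearMap), ?_⟩
  ext x
  have hx : (s.quotKerEquivOfSurjective hs).symm (i x) = Submodule.Quotient.mk (0, x) := by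
    rw [LinearEquiv.symm_apply_eq]
    change i x = l 0 + i x
    rw [map_zero, zero_add]
  change (LinearMap.ker s).liftQ t hst ((s.quotKerEquivOfSurjective hs).symm (i x)) = f x
  rw [hx]
  change m 0 + f x = f x
  rw [map_zero, zero_add]

/-- A module stably isomorphic to a Gorenstein projective module is Gorenstein projective. -/
theorem GProj.of_retract_complement {C L W : ModuleCat.{w} R} (hC : GProj R C) [Projective W]
    (i : C ⟶ L) (r : L ⟶ C) (hir : i ≫ r = 𝟙 C) (a : L ⟶ W) (b : W ⟶ L)
    (hab : a ≫ b + r ≫ i = 𝟙 L) : GProj R L := by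
  have hirx : ∀ x, r (i x) = x := fun x => congrArg (fun k => k.hom x) hir
  have habx : ∀ x, b (a x) + i (r x) = x := fun x => congrArg (fun k => k.hom x) hab
  let K := LinearMap.ker r.hom
  have hW := ModuleCat.projective_of_module_projective W
  have hb : ∀ x, r (b x - i (r (b x))) = 0 := fun x => by rw [map_sub, hirx, sub_self]
  -- The kernel of `r` is a summand of `W`: `a` embeds it, with retraction `b` followed by the
  -- projection 1 - ir onto the kernel.
  have hK : Module.Projective R K := by
    refine Module.Projective.of_split (a.hom ∘ₗ K.subtype)
      ((b.hom - i.hom ∘ₗ r.hom ∘ₗ b.hom).codRestrict K hb) ?_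
    ext x
    have hx : r x.1 = 0 := x.2
    have h₁ : b (a x.1) = x.1 := by
      have := habx x.1
      rwa [hx, map_zero, add_zero] at this
    change b (a x.1) - i (r (b (a x.1))) = x.1
    rw [h₁, hx, map_zero, sub_zero]
  have hK' : Projective (ModuleCat.of R K) := (IsProjective.iff_projective _).1 hK
  -- Since `i` splits `r`, `L` is the direct sum of `C` and the projective module `K`.
  refine (hC.prod (GProj.of_projective (ModuleCat.of R K))).of_iso (LinearEquiv.toModuleIso
    (LinearEquiv.ofBijective (i.hom.coprod K.subtype) ⟨?_, ?_⟩))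
  · rw [← LinearMap.ker_eq_bot, LinearMap.ker_eq_bot']
    rintro ⟨c, x⟩ (h : i c + x.1 = 0)
    have hx : r x.1 = 0 := x.2
    have hc : c = 0 := by
      have := congrArg r h
      rwa [map_add, hirx, hx, map_zero, add_zero] at this
    subst hc
    rw [map_zero, zero_add] at h
    exact Prod.ext rfl (Subtype.ext h)
  · intro x
    refine ⟨(r x, ⟨x - i (r x), ?_⟩), ?_⟩
    · change r (x - i (r x)) = 0
      rw [map_sub, hirx, sub_self]
    · change i (r x) + (x - i (r x)) = x
      abel

end Syzygies

/-! ### Functors preserving Gorenstein projectivity -/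

section Functors

variable {R : Type u} [Ring R] {S : Type v} [Ring S]

open Limits

/-- An exact functor preserving projective modules, whose right adjoint preserves projective
modules, preserves Gorenstein projective modules. -/
theorem GProj.map [Small.{w} R] [Small.{w} S] {F : ModuleCat.{w} R ⥤ ModuleCat.{w} S} {G : ModuleCat.{w} S ⥤ ModuleCat.{w} R}
    (adj : F ⊣ G) [PreservesFiniteLimits F]
    (hF : ∀ X, Projective X → Projective (F.obj X)) (hG : ∀ X, Projective X → Projective (G.obj X))
    {X : ModuleCat.{w} R} (hX : GProj R X) : GProj S (F.obj X) := by
  have := adj.leftAdjoint_preservesColimits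
  obtain ⟨g, hg, ⟨α⟩⟩ := hX.exists_chain
  refine (GProj.of_chain (g := fun n => F.obj (g n)) (fun n => ?_) 0).of_iso (F.mapIso α)
  obtain ⟨P, i, p, hw, hS, hP, hQ⟩ := hg n
  refine ⟨F.obj P, F.map i, F.map p, by rw [← F.map_comp, hw, F.map_zero], hS.map_of_exact F,
    hF P hP, fun Q hQ' f => ?_⟩
  -- By adjunction, extending a map into `Q` amounts to extending a map into the projective module
  -- `G.obj Q`.
  have := hG Q hQ'
  obtain ⟨k, hk⟩ := hQ (G.obj Q) (adj.homEquiv _ _ f)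
  exact ⟨(adj.homEquiv _ _).symm k, by
    rw [← adj.homEquiv_naturality_left_symm, hk, Equiv.symm_apply_apply]⟩

variable [Small.{w} R] [Small.{w} S]

theorem GProj.map_equivalence (F : ModuleCat.{w} R ⥤ ModuleCat.{w} S) [F.IsEquivalence]
    {X : ModuleCat.{w} R} (hX : GProj R X) : GProj S (F.obj X) :=
  GProj.map F.asEquivalence.toAdjunction
    (fun X hX => F.asEquivalence.toAdjunction.map_projective X hX)
    (fun X hX => F.asEquivalence.symm.toAdjunction.map_projective X hX) hX

theorem GProj.map_equivalence_iff (F : ModuleCat.{w} R ⥤ ModuleCat.{w} S) [F.IsEquivalence]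
    {X : ModuleCat.{w} R} : GProj S (F.obj X) ↔ GProj R X :=
  ⟨fun h => (GProj.map_equivalence F.inv h).of_iso (F.asEquivalence.unitIso.app X).symm,
    GProj.map_equivalence F⟩

end Functors

/-! ### Syzygies and cosyzygies up to projective summands -/

section StableComparison

variable {S : Type u} [Ring S] [Small.{w} S]

/-- A split epimorphism `q` under `N` induces a map `L ⟶ C` on cokernels. Once its section is
compatible with the embeddings of `N`, this map splits too, and the complementary idempotent on `L`
factors through the projective `W`. -/
theorem GProj.of_cosyzygy_comparison {N W L P C : ModuleCat.{w} S} (hC : GProj S C)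
    [Projective W] {j : N ⟶ W} {g : W ⟶ L} {hjg : j ≫ g = 0}
    (hL : (ShortComplex.mk j g hjg).ShortExact) {i : N ⟶ P} {p : P ⟶ C} {hip : i ≫ p = 0}
    (hS : (ShortComplex.mk i p hip).ShortExact) (hext : ∃ k : P ⟶ W, i ≫ k = j)
    (q : W ⟶ P) (s : P ⟶ W) (hsq : s ≫ q = 𝟙 P) (hjq : j ≫ q = i) : GProj S L := by
  obtain ⟨k, hk⟩ := hext
  have : Epi g := hL.epi_g
  have : Epi p := hS.epi_g
  have descL : ∀ {Z : ModuleCat.{w} S} (f : W ⟶ Z), j ≫ f = 0 → ∃ f' : L ⟶ Z, g ≫ f' = f :=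
    fun f hf => ⟨_, hL.gIsCokernel.fac (Limits.CokernelCofork.ofπ f hf) .one⟩
  have descC : ∀ {Z : ModuleCat.{w} S} (f : P ⟶ Z), i ≫ f = 0 → ∃ f' : C ⟶ Z, p ≫ f' = f :=
    fun f hf => ⟨_, hS.gIsCokernel.fac (Limits.CokernelCofork.ofπ f hf) .one⟩
  -- `k` respects the embeddings but need not be a section, and `s` the reverse; this combination
  -- has both properties.
  obtain ⟨s', hs', his'⟩ : ∃ s' : P ⟶ W, s' ≫ q = 𝟙 P ∧ i ≫ s' = j := by
    refine ⟨k + s - k ≫ q ≫ s, ?_, ?_⟩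
    · simp [hsq]
    · simp [reassoc_of% hk, reassoc_of% hjq, hk]
  obtain ⟨v, hv⟩ := descL (q ≫ p) (by rw [reassoc_of% hjq, hip])
  obtain ⟨c, hc⟩ := descC (s' ≫ g) (by rw [reassoc_of% his', hjg])
  obtain ⟨a, ha⟩ := descL (𝟙 W - q ≫ s') (by simp [reassoc_of% hjq, his'])
  refine hC.of_retract_complement c v ?_ a g ?_
  · rw [← cancel_epi p, reassoc_of% hc, hv, reassoc_of% hs', Category.comp_id]
  · rw [← cancel_epi g, Preadditive.comp_add, reassoc_of% ha, reassoc_of% hv, hc]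
    simp

/-- Dual argument, on kernels. Here the retraction of `s` is corrected, by means of a lift of `j`
through `p` that projectivity of `W` supplies. -/
theorem GProj.of_syzygy_comparison {N W L P K : ModuleCat.{w} S} (hK : GProj S K)
    [Projective W] {g : L ⟶ W} {j : W ⟶ N} {hgj : g ≫ j = 0}
    (hL : (ShortComplex.mk g j hgj).ShortExact) {i : K ⟶ P} {p : P ⟶ N} {hip : i ≫ p = 0}
    (hS : (ShortComplex.mk i p hip).ShortExact)
    (q : W ⟶ P) (s : P ⟶ W) (hsq : s ≫ q = 𝟙 P) (hsj : s ≫ j = p) : GProj S L := by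
  have : Mono g := hL.mono_f
  have : Mono i := hS.mono_f
  have : Epi p := hS.epi_g
  have liftL : ∀ {Z : ModuleCat.{w} S} (f : Z ⟶ W), f ≫ j = 0 → ∃ f' : Z ⟶ L, f' ≫ g = f :=
    fun f hf => ⟨_, hL.fIsKernel.fac (Limits.KernelFork.ofι f hf) .zero⟩
  have liftK : ∀ {Z : ModuleCat.{w} S} (f : Z ⟶ P), f ≫ p = 0 → ∃ f' : Z ⟶ K, f' ≫ i = f :=
    fun f hf => ⟨_, hS.fIsKernel.fac (Limits.KernelFork.ofι f hf) .zero⟩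
  obtain ⟨k, hk⟩ : ∃ k : W ⟶ P, k ≫ p = j := ⟨_, Projective.factorThru_comp j p⟩
  obtain ⟨q', hq', hqp'⟩ : ∃ q' : W ⟶ P, s ≫ q' = 𝟙 P ∧ q' ≫ p = j := by
    refine ⟨k + q - q ≫ s ≫ k, ?_, ?_⟩
    · simp [hsq, reassoc_of% hsq]
    · simp [hk, hsj]
  obtain ⟨c, hc⟩ := liftL (i ≫ s) (by rw [Category.assoc, hsj, hip])
  obtain ⟨v, hv⟩ := liftK (g ≫ q') (by rw [Category.assoc, hqp', hgj])
  obtain ⟨b, hb⟩ := liftL (𝟙 W - q' ≫ s) (by simp [hsj, hqp'])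
  refine hK.of_retract_complement c v ?_ g b ?_
  · rw [← cancel_mono i, Category.assoc, hv, reassoc_of% hc, hq', Category.id_comp,
      Category.comp_id]
  · rw [← cancel_mono g, Preadditive.add_comp, Category.assoc, Category.assoc, hb, hc,
      reassoc_of% hv]
    simp

end StableComparison

/-! ### Frobenius pairs: Gorenstein projectivity is tested on components -/

open Limits

/-- A pair of jointly faithful functors `e₀, e₁ : R-Mod ⥤ S-Mod` with fully faithful adjoints
`t₀ ⊣ e₀ ⊣ t₁` and, up to an autoequivalence `s` of `S-Mod`, `t₁ ⊣ e₁ ⊣ t₀`. -/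
structure FrobeniusPair (R : Type u) [Ring R] (S : Type v) [Ring S] where
  e₀ : ModuleCat.{w} R ⥤ ModuleCat.{w} S
  e₁ : ModuleCat.{w} R ⥤ ModuleCat.{w} S
  t₀ : ModuleCat.{w} S ⥤ ModuleCat.{w} R
  t₁ : ModuleCat.{w} S ⥤ ModuleCat.{w} R
  s : ModuleCat.{w} S ⥤ ModuleCat.{w} S
  isEquivalence_s : s.IsEquivalence
  full_t₀ : t₀.Full
  faithful_t₀ : t₀.Faithful
  full_t₁ : t₁.Full
  faithful_t₁ : t₁.Faithful
  adj₀₀ : t₀ ⊣ e₀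
  adj₁₀ : e₁ ⊣ t₀
  adj₀₁ : e₀ ⊣ t₁
  adj₁₁ : t₁ ⊣ e₁ ⋙ s
  additive_e₀ : e₀.Additive
  additive_e₁ : e₁.Additive
  jointly_faithful : ∀ {X Y : ModuleCat.{w} R} (f : X ⟶ Y), e₀.map f = 0 → e₁.map f = 0 → f = 0

namespace FrobeniusPair

variable {R : Type u} [Ring R] {S : Type v} [Ring S]
  (F : FrobeniusPair.{u, v, w} R S)

attribute [instance] isEquivalence_s full_t₀ faithful_t₀ full_t₁ faithful_t₁ additive_e₀ additive_e₁

instance : PreservesLimits F.e₀ := F.adj₀₀.rightAdjoint_preservesLimits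
instance : PreservesColimits F.e₀ := F.adj₀₁.leftAdjoint_preservesColimits
instance : PreservesLimits (F.e₁ ⋙ F.s) := F.adj₁₁.rightAdjoint_preservesLimits
instance : PreservesLimits F.e₁ := preservesLimits_of_reflects_of_preserves F.e₁ F.s
instance : PreservesColimits F.e₁ := F.adj₁₀.leftAdjoint_preservesColimits
instance : PreservesColimits F.t₀ := F.adj₀₀.leftAdjoint_preservesColimits
instance : PreservesColimits F.t₁ := F.adj₁₁.leftAdjoint_preservesColimits

theorem projective_t₀ {X : ModuleCat.{w} S} (hX : Projective X) : Projective (F.t₀.obj X) :=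
  F.adj₀₀.map_projective X hX

theorem projective_t₁ {X : ModuleCat.{w} S} (hX : Projective X) : Projective (F.t₁.obj X) :=
  F.adj₁₁.map_projective X hX

theorem projective_e₀ {X : ModuleCat.{w} R} (hX : Projective X) : Projective (F.e₀.obj X) :=
  F.adj₀₁.map_projective X hX

theorem projective_e₁ {X : ModuleCat.{w} R} (hX : Projective X) : Projective (F.e₁.obj X) :=
  F.adj₁₀.map_projective X hX

theorem projective_s {X : ModuleCat.{w} S} (hX : Projective X) : Projective (F.s.obj X) :=
  F.s.asEquivalence.toAdjunction.map_projective X hX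

theorem mono_of_mono {X Y : ModuleCat.{w} R} (f : X ⟶ Y) [Mono (F.e₀.map f)]
    [Mono (F.e₁.map f)] : Mono f := by
  refine Preadditive.mono_of_cancel_zero f fun g hg => F.jointly_faithful g ?_ ?_
  · rw [← cancel_mono (F.e₀.map f), ← F.e₀.map_comp, hg]
    simp
  · rw [← cancel_mono (F.e₁.map f), ← F.e₁.map_comp, hg]
    simp

theorem epi_of_epi {X Y : ModuleCat.{w} R} (f : X ⟶ Y) [Epi (F.e₀.map f)]
    [Epi (F.e₁.map f)] : Epi f := by
  refine Preadditive.epi_of_cancel_zero f fun g hg => F.jointly_faithful g ?_ ?_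
  · rw [← cancel_epi (F.e₀.map f), ← F.e₀.map_comp, hg]
    simp
  · rw [← cancel_epi (F.e₁.map f), ← F.e₁.map_comp, hg]
    simp

/-- The modules with Gorenstein projective components. -/
def components : ObjectProperty (ModuleCat.{w} R) :=
  fun X => GProj S (F.e₀.obj X) ∧ GProj S (F.e₁.obj X)

variable [Small.{w} S]

/-- A projective module is a quotient of `t₀ e₀ Q ⊞ t₁ s e₁ Q`. -/
theorem exists_extension {X T Y Q : ModuleCat.{w} R} [Projective Q] {j : X ⟶ T} {g : T ⟶ Y}
    {hjg : j ≫ g = 0} (hS : (ShortComplex.mk j g hjg).ShortExact) (hY : F.components Y)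
    (f : X ⟶ Q) : ∃ k, j ≫ k = f := by
  let V := F.s.obj (F.e₁.obj Q)
  let c : F.t₀.obj (F.e₀.obj Q) ⊞ F.t₁.obj V ⟶ Q :=
    biprod.desc (F.adj₀₀.counit.app Q) (F.adj₁₁.counit.app Q)
  -- By the triangle identities each counit becomes a split epimorphism under its right adjoint, so
  -- joint faithfulness makes `c` epi.
  have h₀ : Epi (F.e₀.map c) := by
    have : F.adj₀₀.unit.app _ ≫ F.e₀.map (biprod.inl ≫ c) = 𝟙 _ := by
      rw [biprod.inl_desc]
      exact F.adj₀₀.right_triangle_components Q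
    rw [F.e₀.map_comp, ← Category.assoc] at this
    exact epi_of_epi_fac this
  have h₁ : Epi (F.e₁.map c) := by
    have : F.adj₁₁.unit.app _ ≫ (F.e₁ ⋙ F.s).map (biprod.inr ≫ c) = 𝟙 _ := by
      rw [biprod.inr_desc]
      exact F.adj₁₁.right_triangle_components Q
    rw [(F.e₁ ⋙ F.s).map_comp, ← Category.assoc] at this
    have : Epi (F.s.map (F.e₁.map c)) := epi_of_epi_fac this
    exact F.s.epi_of_epi_map this
  have := F.epi_of_epi c
  have hQ₀ := F.projective_e₀ (X := Q) inferInstance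
  have hQ₁ : Projective V := F.projective_s (F.projective_e₁ (X := Q) inferInstance)
  obtain ⟨d, hd⟩ : ∃ d, d ≫ c = 𝟙 Q := ⟨_, Projective.factorThru_comp (𝟙 Q) c⟩
  -- The indices cross: maps into `t₀` correspond to maps out of `e₁`, and maps into `t₁` to maps
  -- out of `e₀`. Both extend since Ext¹ from the components of `Y` to projectives vanishes.
  obtain ⟨k₀, hk₀⟩ := hY.2.exists_extension _ (hS.map_of_exact F.e₁)
    ((F.adj₁₀.homEquiv _ _).symm (f ≫ d ≫ biprod.fst))
  obtain ⟨k₁, hk₁⟩ := hY.1.exists_extension _ (hS.map_of_exact F.e₀)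
    ((F.adj₀₁.homEquiv _ _).symm (f ≫ d ≫ biprod.snd))
  refine ⟨biprod.lift (F.adj₁₀.homEquiv _ _ k₀) (F.adj₀₁.homEquiv _ _ k₁) ≫ c, ?_⟩
  have key : j ≫ biprod.lift (F.adj₁₀.homEquiv _ _ k₀) (F.adj₀₁.homEquiv _ _ k₁) = f ≫ d := by
    apply biprod.hom_ext
    · rw [Category.assoc, biprod.lift_fst, ← F.adj₁₀.homEquiv_naturality_left, Category.assoc]
      exact (F.adj₁₀.homEquiv _ _).symm_apply_eq.1 hk₀.symm ▸ rfl
    · rw [Category.assoc, biprod.lift_snd, ← F.adj₀₁.homEquiv_naturality_left, Category.assoc]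
      exact (F.adj₀₁.homEquiv _ _).symm_apply_eq.1 hk₁.symm ▸ rfl
  rw [reassoc_of% key, hd, Category.comp_id]

/-- Embeddings of `e₁ X` and `e₀ X` into projectives are adjoint to maps into `t₀ P₁` and `t₁ P₀`;
together these embed `X` in a projective. The extra summand in each component of `T` is absorbed by
the stable comparison. -/
theorem components_cosyzygy {X : ModuleCat.{w} R} (hX : F.components X) :
    ∃ Y, F.components Y ∧ IsSyzygy X Y := by
  obtain ⟨C₀, hC₀, P₀, i₀, p₀, hw₀, hS₀, hP₀, hQ₀⟩ := hX.1.exists_cosyzygy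
  obtain ⟨C₁, hC₁, P₁, i₁, p₁, hw₁, hS₁, hP₁, hQ₁⟩ := hX.2.exists_cosyzygy
  have := F.projective_t₀ hP₁
  have := F.projective_t₁ hP₀
  let T := F.t₀.obj P₁ ⊞ F.t₁.obj P₀
  let j : X ⟶ T := biprod.lift (F.adj₁₀.homEquiv _ _ i₁) (F.adj₀₁.homEquiv _ _ i₀)
  have hT : Projective T := inferInstance
  have hj₁ : F.e₁.map j ≫ F.e₁.map biprod.fst ≫ F.adj₁₀.counit.app P₁ = i₁ := by
    rw [← Category.assoc, ← F.e₁.map_comp, biprod.lift_fst]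
    exact (F.adj₁₀.homEquiv_counit _ _ _).symm.trans (Equiv.symm_apply_apply _ _)
  have hj₀ : F.e₀.map j ≫ F.e₀.map biprod.snd ≫ F.adj₀₁.counit.app P₀ = i₀ := by
    rw [← Category.assoc, ← F.e₀.map_comp, biprod.lift_snd]
    exact (F.adj₀₁.homEquiv_counit _ _ _).symm.trans (Equiv.symm_apply_apply _ _)
  have : Mono i₀ := hS₀.mono_f
  have : Mono i₁ := hS₁.mono_f
  have : Mono (F.e₀.map j) := mono_of_mono_fac hj₀
  have : Mono (F.e₁.map j) := mono_of_mono_fac hj₁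
  have := F.mono_of_mono j
  have hS : (ShortComplex.mk j (cokernel.π j) (cokernel.condition j)).ShortExact :=
    .mk (ShortComplex.exact_cokernel j)
  have hY : F.components (cokernel j) := by
    have := F.projective_e₀ hT
    have := F.projective_e₁ hT
    constructor
    -- The counit at `P₀` is invertible because `t₁` is fully faithful, which gives the section.
    · refine hC₀.of_cosyzygy_comparison (hS.map_of_exact F.e₀) hS₀ (hQ₀ _ _) _
        (inv (F.adj₀₁.counit.app P₀) ≫ F.e₀.map biprod.inr) ?_ hj₀
      rw [Category.assoc, ← F.e₀.map_comp_assoc, biprod.inr_snd]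
      simp
    · refine hC₁.of_cosyzygy_comparison (hS.map_of_exact F.e₁) hS₁ (hQ₁ _ _) _
        (inv (F.adj₁₀.counit.app P₁) ≫ F.e₁.map biprod.inl) ?_ hj₁
      rw [Category.assoc, ← F.e₁.map_comp_assoc, biprod.inl_fst]
      simp
  exact ⟨_, hY, T, j, cokernel.π j, _, hS, hT, fun Q _ f => F.exists_extension hS hY f⟩

/-- Dual construction with covers. The right adjoint of `t₁` is `e₁ ⋙ s`, so the second cover is one
of `s e₁ Y`, and the conclusion is carried back along the equivalence `s`. -/
theorem components_syzygy {Y : ModuleCat.{w} R} (hY : F.components Y) :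
    ∃ X, F.components X ∧ IsSyzygy X Y := by
  obtain ⟨K₀, hK₀, P₀, i₀, p₀, hw₀, hS₀, hP₀, -⟩ := hY.1.exists_syzygy
  obtain ⟨K₁, hK₁, P₁, i₁, p₁, hw₁, hS₁, hP₁, -⟩ := (hY.2.map_equivalence F.s).exists_syzygy
  have := F.projective_t₀ hP₀
  have := F.projective_t₁ hP₁
  let T := F.t₀.obj P₀ ⊞ F.t₁.obj P₁
  let j : T ⟶ Y := biprod.desc ((F.adj₀₀.homEquiv _ _).symm p₀) ((F.adj₁₁.homEquiv _ _).symm p₁)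
  have hT : Projective T := inferInstance
  have hj₀ : (F.adj₀₀.unit.app P₀ ≫ F.e₀.map biprod.inl) ≫ F.e₀.map j = p₀ := by
    rw [Category.assoc, ← F.e₀.map_comp, biprod.inl_desc]
    exact (F.adj₀₀.homEquiv_unit _ _ _).symm.trans (Equiv.apply_symm_apply _ _)
  have hj₁ : (F.adj₁₁.unit.app P₁ ≫ (F.e₁ ⋙ F.s).map biprod.inr) ≫ (F.e₁ ⋙ F.s).map j = p₁ := by
    rw [Category.assoc, ← (F.e₁ ⋙ F.s).map_comp, biprod.inr_desc]
    exact (F.adj₁₁.homEquiv_unit _ _ _).symm.trans (Equiv.apply_symm_apply _ _)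
  have : Epi p₀ := hS₀.epi_g
  have : Epi p₁ := hS₁.epi_g
  have : Epi (F.e₀.map j) := epi_of_epi_fac hj₀
  have : Epi (F.s.map (F.e₁.map j)) := epi_of_epi_fac hj₁
  have : Epi (F.e₁.map j) := F.s.epi_of_epi_map this
  have := F.epi_of_epi j
  have hS : (ShortComplex.mk (kernel.ι j) j (kernel.condition j)).ShortExact :=
    .mk (ShortComplex.exact_kernel j)
  refine ⟨kernel j, ⟨?_, (GProj.map_equivalence_iff F.s).1 ?_⟩, T, kernel.ι j, j, _, hS, hT,
    fun Q _ f => F.exists_extension hS hY f⟩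
  · have := F.projective_e₀ hT
    refine hK₀.of_syzygy_comparison (hS.map_of_exact F.e₀) hS₀
      (F.e₀.map biprod.fst ≫ inv (F.adj₀₀.unit.app P₀)) _ ?_ hj₀
    rw [Category.assoc, ← F.e₀.map_comp_assoc, biprod.inl_fst]
    simp
  · have : Projective ((F.e₁ ⋙ F.s).obj T) := F.projective_s (F.projective_e₁ hT)
    refine hK₁.of_syzygy_comparison (hS.map_of_exact (F.e₁ ⋙ F.s)) hS₁
      ((F.e₁ ⋙ F.s).map biprod.snd ≫ inv (F.adj₁₁.unit.app P₁)) _ ?_ hj₁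
    rw [Category.assoc, ← (F.e₁ ⋙ F.s).map_comp_assoc, biprod.inr_snd]
    simp

variable [Small.{w} R]

theorem gProj_e₀ {X : ModuleCat.{w} R} (hX : GProj R X) : GProj S (F.e₀.obj X) :=
  hX.map F.adj₀₁ (fun _ => F.projective_e₀) (fun _ => F.projective_t₁)

theorem gProj_e₁ {X : ModuleCat.{w} R} (hX : GProj R X) : GProj S (F.e₁.obj X) :=
  hX.map F.adj₁₀ (fun _ => F.projective_e₁) (fun _ => F.projective_t₀)

/-- A module is Gorenstein projective if and only if its components are. -/
theorem gProj_iff {X : ModuleCat.{w} R} :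
    GProj R X ↔ GProj S (F.e₀.obj X) ∧ GProj S (F.e₁.obj X) :=
  ⟨fun hX => ⟨F.gProj_e₀ hX, F.gProj_e₁ hX⟩, fun hX => GProj.of_class (P := F.components)
    (fun _ => F.components_cosyzygy) (fun _ => F.components_syzygy) hX⟩

end FrobeniusPair

/-! ### Trivial factorizations and their adjunctions -/

namespace Factorization

section Adjunctions

variable {C : Type u} [Category.{v} C] (T : C ⥤ C) (ω : 𝟭 C ⟶ T)

/-- The functor `U ↦ (U, U; 1, ω)`. -/
@[simps]
def trivial₀ : C ⥤ Factorization T ω where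
  obj U :=
    { obj₀ := U
      obj₁ := U
      d₀ := 𝟙 U
      d₁ := ω.app U
      d₀_d₁ := by simp
      d₁_d₀ := by simp }
  map f := ⟨f, f, by simp, ω.naturality f⟩

/-- The functor `V ↦ (V, T V; ω, 1)`. -/
@[simps]
def trivial₁ (hω : ∀ V, T.map (ω.app V) = ω.app (T.obj V)) : C ⥤ Factorization T ω where
  obj V :=
    { obj₀ := V
      obj₁ := T.obj V
      d₀ := ω.app V
      d₁ := 𝟙 (T.obj V)
      d₀_d₁ := by simp
      d₁_d₀ := by simp [hω] }
  map f := ⟨f, T.map f, ω.naturality f, by simp⟩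

instance : (trivial₀ T ω).Full where
  map_surjective f := ⟨f.f₀, hom_ext rfl
    ((Category.comp_id _).symm.trans (f.comm₀.trans (Category.id_comp _)))⟩

instance : (trivial₀ T ω).Faithful where
  map_injective h := congrArg Hom.f₀ h

variable (hω : ∀ V, T.map (ω.app V) = ω.app (T.obj V))

instance : (trivial₁ T ω hω).Full where
  map_surjective f := ⟨f.f₀, hom_ext rfl
    ((Category.id_comp _).symm.trans (f.comm₁.symm.trans (Category.comp_id _)))⟩

instance : (trivial₁ T ω hω).Faithful where
  map_injective h := congrArg Hom.f₀ h

variable {T ω}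

/-- This and the next three lemmas are the compatibility squares of the adjunctions: a factorization
identity combined with naturality of `ω`. -/
theorem comp_d₀_d₁ (X : Factorization T ω) {U : C} (g : U ⟶ X.obj₀) :
    (g ≫ X.d₀) ≫ X.d₁ = ω.app U ≫ T.map g := by
  rw [Category.assoc, X.d₀_d₁]
  exact ω.naturality g

theorem d₀_d₁_map (X : Factorization T ω) {V : C} (g : X.obj₀ ⟶ V) :
    X.d₀ ≫ X.d₁ ≫ T.map g = g ≫ ω.app V := by
  rw [← Category.assoc, X.d₀_d₁]
  exact (ω.naturality g).symm

theorem d₁_map_d₀_comp (X : Factorization T ω) {U : C} (g : X.obj₁ ⟶ U) :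
    X.d₁ ≫ T.map (X.d₀ ≫ g) = g ≫ ω.app U := by
  rw [T.map_comp, ← Category.assoc, X.d₁_d₀]
  exact (ω.naturality g).symm

theorem comp_d₁_map_d₀ (X : Factorization T ω) {V : C} (g : V ⟶ X.obj₁) :
    (g ≫ X.d₁) ≫ T.map X.d₀ = ω.app V ≫ T.map g := by
  rw [Category.assoc, X.d₁_d₀]
  exact ω.naturality g

variable (T ω)

/-- `U ↦ (U, U; 1, ω)` is left adjoint to `X ↦ X⁰`. -/
def trivial₀Adj : trivial₀ T ω ⊣ pr₀ T ω :=
  Adjunction.mkOfHomEquiv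
    { homEquiv _ X :=
        { toFun f := f.f₀
          invFun g := ⟨g, g ≫ X.d₀, (Category.id_comp _).symm, X.comp_d₀_d₁ g⟩
          left_inv f := hom_ext rfl (f.comm₀.trans (Category.id_comp _))
          right_inv _ := rfl }
      homEquiv_naturality_left_symm _ _ := hom_ext rfl (Category.assoc _ _ _)
      homEquiv_naturality_right _ _ := rfl }

/-- `U ↦ (U, U; 1, ω)` is right adjoint to `X ↦ X¹`. -/
def pr₁Adj : pr₁ T ω ⊣ trivial₀ T ω :=
  Adjunction.mkOfHomEquiv
    { homEquiv X _ :=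
        { toFun g := ⟨X.d₀ ≫ g, g, Category.comp_id _, (X.d₁_map_d₀_comp g).symm⟩
          invFun f := f.f₁
          left_inv _ := rfl
          right_inv f := hom_ext (f.comm₀.symm.trans (Category.comp_id _)) rfl }
      homEquiv_naturality_left_symm _ _ := rfl
      homEquiv_naturality_right _ _ := hom_ext (Category.assoc _ _ _).symm rfl }

/-- `V ↦ (V, T V; ω, 1)` is right adjoint to `X ↦ X⁰`. -/
def pr₀Adj : pr₀ T ω ⊣ trivial₁ T ω hω :=
  Adjunction.mkOfHomEquiv
    { homEquiv X _ :=
        { toFun g := ⟨g, X.d₁ ≫ T.map g, (X.d₀_d₁_map g).symm, Category.comp_id _⟩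
          invFun f := f.f₀
          left_inv _ := rfl
          right_inv f := hom_ext rfl (f.comm₁.symm.trans (Category.comp_id _)) }
      homEquiv_naturality_left_symm _ _ := rfl
      homEquiv_naturality_right _ _ := hom_ext rfl
        ((congrArg _ (T.map_comp _ _)).trans (Category.assoc _ _ _).symm) }

/-- Morphisms `(V, T V; ω, 1) ⟶ X` are morphisms `T V ⟶ X¹`, for `T` fully faithful. -/
noncomputable def trivial₁HomEquiv [T.Full] [T.Faithful] (V : C) (X : Factorization T ω) :
    ((trivial₁ T ω hω).obj V ⟶ X) ≃ (T.obj V ⟶ X.obj₁) where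
  toFun f := f.f₁
  -- Compatibility with `d₁` forces the image of `f₀` under `T` to be `g ≫ X.d₁`. The other square
  -- is checked after applying `T`, where `hω` enters.
  invFun g := ⟨T.preimage (g ≫ X.d₁), g, T.map_injective ((T.map_comp _ _).trans
      ((congrArg (· ≫ T.map X.d₀) (T.map_preimage _)).trans ((X.comp_d₁_map_d₀ g).trans
        ((congrArg (· ≫ T.map g) (hω V).symm).trans (T.map_comp _ _).symm)))),
    ((Category.id_comp _).trans (T.map_preimage _)).symm⟩
  left_inv f := hom_ext (T.map_injective ((T.map_preimage _).trans
    (f.comm₁.trans (Category.id_comp _)))) rfl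
  right_inv _ := rfl

/-- `V ↦ (V, T V; ω, 1)` is left adjoint to `X ↦ T⁻¹ X¹`, for `T` an equivalence. -/
noncomputable def trivial₁Adj [T.IsEquivalence] : trivial₁ T ω hω ⊣ pr₁ T ω ⋙ T.inv :=
  Adjunction.mkOfHomEquiv
    { homEquiv V X := (trivial₁HomEquiv T ω hω V X).trans
        (T.asEquivalence.toAdjunction.homEquiv V X.obj₁)
      homEquiv_naturality_left_symm {V _ X} f g :=
        (trivial₁HomEquiv T ω hω V X).injective
          (T.asEquivalence.toAdjunction.homEquiv_naturality_left_symm f g)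
      homEquiv_naturality_right f g :=
        T.asEquivalence.toAdjunction.homEquiv_naturality_right f.f₁ g.f₁ }

end Adjunctions

end Factorization

/-! ### From module factorizations to modules over the twisted matrix ring -/

section ModFact

variable {A : Type u} [Ring A] {ω : A} {σ : A ≃+* A} {h : IsNormalTwist ω σ}

namespace ModFact

/-- The component `X⁰ → X¹` of a module factorization. -/
noncomputable def δ₀ (X : ModFact.{u, w} h) : X.obj₀ →ₗ[A] X.obj₁ := X.d₀.hom

/-- The component `X¹ → X⁰` of a module factorization, as a semilinear map. -/
noncomputable def δ₁ (X : ModFact.{u, w} h) : X.obj₁ →ₛₗ[(σ : A →+* A)] X.obj₀ where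
  toFun x := X.d₁.hom x
  map_add' x y := X.d₁.hom.map_add x y
  map_smul' a x := X.d₁.hom.map_smul a x

@[simp]
theorem δ₁_δ₀ (X : ModFact.{u, w} h) (x : X.obj₀) : X.δ₁ (X.δ₀ x) = ω • x :=
  congrArg (fun k => k.hom x) X.d₀_d₁

@[simp]
theorem δ₀_δ₁ (X : ModFact.{u, w} h) (x : X.obj₁) : X.δ₀ (X.δ₁ x) = ω • x :=
  congrArg (fun k => k.hom x) X.d₁_d₀

theorem hom_δ₀ {X Y : ModFact.{u, w} h} (f : X ⟶ Y) (x : X.obj₀) :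
    f.f₁ (X.δ₀ x) = Y.δ₀ (f.f₀ x) :=
  (congrArg (fun k => k.hom x) f.comm₀).symm

theorem hom_δ₁ {X Y : ModFact.{u, w} h} (f : X ⟶ Y) (x : X.obj₁) :
    f.f₀ (X.δ₁ x) = Y.δ₁ (f.f₁ x) :=
  (congrArg (fun k => k.hom x) f.comm₁).symm

/-- Constructor for morphisms of module factorizations. -/
noncomputable def homMk {X Y : ModFact.{u, w} h} (f₀ : X.obj₀ →ₗ[A] Y.obj₀) (f₁ : X.obj₁ →ₗ[A] Y.obj₁)
    (h₀ : ∀ x, f₁ (X.δ₀ x) = Y.δ₀ (f₀ x)) (h₁ : ∀ x, f₀ (X.δ₁ x) = Y.δ₁ (f₁ x)) : X ⟶ Y where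
  f₀ := ModuleCat.ofHom f₀
  f₁ := ModuleCat.ofHom f₁
  comm₀ := by
    ext x
    exact (h₀ x).symm
  comm₁ := by
    ext x
    exact (h₁ x).symm

/-- Constructor for module factorizations. -/
noncomputable def of (h : IsNormalTwist ω σ) (M₀ M₁ : ModuleCat.{w} A) (δ₀ : M₀ →ₗ[A] M₁)
    (δ₁ : M₁ →ₛₗ[(σ : A →+* A)] M₀)
    (h₀ : ∀ x, δ₁ (δ₀ x) = ω • x) (h₁ : ∀ x, δ₀ (δ₁ x) = ω • x) : ModFact.{u, w} h where
  obj₀ := M₀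
  obj₁ := M₁
  d₀ := ModuleCat.ofHom δ₀
  d₁ := ModuleCat.ofHom (Y := (twist.{u, w} σ).obj M₀)
    { toFun := fun m => δ₁ m
      map_add' := fun x y => δ₁.map_add x y
      map_smul' := fun a x => δ₁.map_smulₛₗ a x }
  d₀_d₁ := by
    ext x
    exact h₀ x
  d₁_d₀ := by
    ext x
    exact h₁ x

/-- The underlying group `X¹ × X⁰` of the module over `M₂(A; ω, σ)` of a module factorization. -/
@[ext]
structure Total (X : ModFact.{u, w} h) : Type w where
  fst : X.obj₁
  snd : X.obj₀

namespace Total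

variable {X : ModFact.{u, w} h}

instance : Zero X.Total := ⟨⟨0, 0⟩⟩
instance : Add X.Total := ⟨fun x y => ⟨x.fst + y.fst, x.snd + y.snd⟩⟩
instance : Neg X.Total := ⟨fun x => ⟨-x.fst, -x.snd⟩⟩

/-- The matrix action on `X¹ × X⁰`. -/
noncomputable instance : SMul (TwistedMatrix h) X.Total where
  smul a x := ⟨a.a₁₁ • x.fst + a.a₁₂ • X.δ₀ x.snd, a.a₂₁ • X.δ₁ x.fst + a.a₂₂ • x.snd⟩

@[simp] theorem fst_zero : (0 : X.Total).fst = 0 := rfl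
@[simp] theorem snd_zero : (0 : X.Total).snd = 0 := rfl
@[simp] theorem fst_add (x y : X.Total) : (x + y).fst = x.fst + y.fst := rfl
@[simp] theorem snd_add (x y : X.Total) : (x + y).snd = x.snd + y.snd := rfl
@[simp] theorem fst_neg (x : X.Total) : (-x).fst = -x.fst := rfl
@[simp] theorem snd_neg (x : X.Total) : (-x).snd = -x.snd := rfl
@[simp] theorem fst_smul (a : TwistedMatrix h) (x : X.Total) :
    (a • x).fst = a.a₁₁ • x.fst + a.a₁₂ • X.δ₀ x.snd := rfl
@[simp] theorem snd_smul (a : TwistedMatrix h) (x : X.Total) :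
    (a • x).snd = a.a₂₁ • X.δ₁ x.fst + a.a₂₂ • x.snd := rfl

theorem smul_mk (a : TwistedMatrix h) (x : X.obj₁) (y : X.obj₀) :
    a • (⟨x, y⟩ : X.Total) = ⟨a.a₁₁ • x + a.a₁₂ • X.δ₀ y, a.a₂₁ • X.δ₁ x + a.a₂₂ • y⟩ := rfl

instance : AddCommGroup X.Total where
  add_assoc x y z := by ext <;> simp [add_assoc]
  zero_add x := by ext <;> simp
  add_zero x := by ext <;> simp
  add_comm x y := by ext <;> simp [add_comm]
  neg_add_cancel x := by ext <;> simp
  nsmul := nsmulRec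
  zsmul := zsmulRec

noncomputable instance : Module (TwistedMatrix h) X.Total where
  one_smul x := by ext <;> simp [TwistedMatrix.one_def]
  mul_smul a b x := by
    -- `δ₁ (b₁₂ • δ₀ y)` gives the coefficient σ(b₁₂)ω, whereas the matrix product has ωb₁₂.
    have key : ω * b.a₁₂ = σ b.a₁₂ * ω := h.mul_eq _
    ext
    · simp only [fst_smul, snd_smul, TwistedMatrix.mul_def, map_add, map_smul, δ₀_δ₁, smul_add,
        add_smul, mul_smul]
      abel
    · simp only [fst_smul, snd_smul, TwistedMatrix.mul_def, map_add, LinearMap.map_smulₛₗ, δ₁_δ₀,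
        smul_add, add_smul, mul_assoc, key]
      simp only [mul_smul, RingHom.coe_coe]
      abel
  smul_zero a := by ext <;> simp
  smul_add a x y := by
    ext
    · simp only [fst_smul, fst_add, snd_add, map_add, smul_add]
      abel
    · simp only [snd_smul, fst_add, snd_add, map_add, smul_add]
      abel
  add_smul a b x := by
    ext
    · simp only [fst_smul, fst_add, TwistedMatrix.add_def, add_smul]
      abel
    · simp only [snd_smul, snd_add, TwistedMatrix.add_def, add_smul]
      abel
  zero_smul x := by ext <;> simp [TwistedMatrix.zero_def]

end Total

end ModFact

open ModFact

/-- The functor `X ↦ X¹ × X⁰` from module factorizations to modules over `M₂(A; ω, σ)`. -/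
noncomputable def totalFunctor (h : IsNormalTwist ω σ) :
    ModFact.{u, w} h ⥤ ModuleCat.{w} (TwistedMatrix h) where
  obj X := ModuleCat.of _ X.Total
  map {X Y} f := ModuleCat.ofHom
    { toFun := fun x : X.Total => (⟨f.f₁ x.fst, f.f₀ x.snd⟩ : Y.Total)
      map_add' := fun x y => by ext <;> simp
      map_smul' := fun a x => by
        ext
        · simp [hom_δ₀]
        · simp [hom_δ₁] }

instance : (totalFunctor.{u, w} h).Additive where
  map_add := rfl

instance : (totalFunctor.{u, w} h).Faithful where
  map_injective {X Y} f g hfg := by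
    have key : ∀ x : X.Total, (⟨f.f₁ x.fst, f.f₀ x.snd⟩ : Y.Total) = ⟨g.f₁ x.fst, g.f₀ x.snd⟩ :=
      fun x => congrArg (fun k => k.hom x) hfg
    ext x
    · exact congrArg Total.snd (key ⟨0, x⟩)
    · exact congrArg Total.fst (key ⟨x, 0⟩)

/-- Commuting with the diagonal idempotents makes a Γ-linear map diagonal, diagonal matrices make
its entries `A`-linear, and the off-diagonal units give compatibility with `δ₀` and `δ₁`. -/
instance : (totalFunctor.{u, w} h).Full where
  map_surjective {X Y} g := by
    let G : X.Total →ₗ[TwistedMatrix h] Y.Total := g.hom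
    have e₁ : ∀ x : X.obj₁, (G ⟨x, 0⟩).snd = 0 := fun x => by
      have := congrArg Total.snd (G.map_smul (⟨1, 0, 0, 0⟩ : TwistedMatrix h) ⟨x, 0⟩)
      simpa [Total.smul_mk] using this
    have e₀ : ∀ x : X.obj₀, (G ⟨0, x⟩).fst = 0 := fun x => by
      have := congrArg Total.fst (G.map_smul (⟨0, 0, 0, 1⟩ : TwistedMatrix h) ⟨0, x⟩)
      simpa [Total.smul_mk] using this
    have s₁ : ∀ (a : A) (x : X.obj₁), (G ⟨a • x, 0⟩).fst = a • (G ⟨x, 0⟩).fst := fun a x => by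
      have := congrArg Total.fst (G.map_smul (⟨a, 0, 0, 0⟩ : TwistedMatrix h) ⟨x, 0⟩)
      simpa [Total.smul_mk] using this
    have s₀ : ∀ (a : A) (x : X.obj₀), (G ⟨0, a • x⟩).snd = a • (G ⟨0, x⟩).snd := fun a x => by
      have := congrArg Total.snd (G.map_smul (⟨0, 0, 0, a⟩ : TwistedMatrix h) ⟨0, x⟩)
      simpa [Total.smul_mk] using this
    have t₀ : ∀ x : X.obj₀, (G ⟨X.δ₀ x, 0⟩).fst = Y.δ₀ (G ⟨0, x⟩).snd := fun x => by
      have := congrArg Total.fst (G.map_smul (⟨0, 1, 0, 0⟩ : TwistedMatrix h) ⟨0, x⟩)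
      simpa [Total.smul_mk] using this
    have t₁ : ∀ x : X.obj₁, (G ⟨0, X.δ₁ x⟩).snd = Y.δ₁ (G ⟨x, 0⟩).fst := fun x => by
      have := congrArg Total.snd (G.map_smul (⟨0, 0, 1, 0⟩ : TwistedMatrix h) ⟨x, 0⟩)
      simpa [Total.smul_mk] using this
    refine ⟨homMk
      { toFun := fun x => (G ⟨0, x⟩).snd
        map_add' := fun x y => by
          rw [← Total.snd_add, ← map_add]
          congr 2
          ext <;> simp
        map_smul' := s₀ }
      { toFun := fun x => (G ⟨x, 0⟩).fst
        map_add' := fun x y => by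
          rw [← Total.fst_add, ← map_add]
          congr 2
          ext <;> simp
        map_smul' := s₁ } t₀ t₁, ?_⟩
    refine ModuleCat.hom_ext (LinearMap.ext fun x : X.Total => ?_)
    have hx : x = (⟨x.fst, 0⟩ : X.Total) + ⟨0, x.snd⟩ := by ext <;> simp
    change (⟨(G ⟨x.fst, 0⟩).fst, (G ⟨0, x.snd⟩).snd⟩ : Y.Total) = G x
    conv_rhs => rw [hx, map_add]
    ext
    · simp [e₀]
    · simp [e₁]

end ModFact

/-! ### Transfer along ring isomorphisms -/

section SemilinearTransfer

variable {R S : Type u} [Ring R] [Ring S] (ε : R ≃+* S)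
  {M N : Type w} [AddCommGroup M] [Module R M] [AddCommGroup N] [Module S N]

/-- A bijection which is semilinear over a ring isomorphism, as an isomorphism of modules. -/
noncomputable def ModuleCat.restrictScalarsIso (e : M ≃+ N) (he : ∀ r m, e (r • m) = ε r • e m) :
    (ModuleCat.restrictScalars.{w} ε.symm.toRingHom).obj (ModuleCat.of R M) ≅ ModuleCat.of S N :=
  let Z := (ModuleCat.restrictScalars.{w} ε.symm.toRingHom).obj (ModuleCat.of R M)
  let f : Z →ₗ[S] N :=
    { toFun := fun m => e m
      map_add' := fun m m' => e.map_add m m'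
      map_smul' := fun s m => by
        have := he (ε.symm s) m
        rw [ε.apply_symm_apply] at this
        exact this }
  (LinearEquiv.ofBijective f e.bijective).toModuleIso

variable [Small.{w} R] [Small.{w} S]

theorem IsGorensteinProjective.of_semilinear (e : M ≃+ N) (he : ∀ r m, e (r • m) = ε r • e m)
    (hM : IsGorensteinProjective R M) : IsGorensteinProjective S N :=
  GProj.of_iso (GProj.map_equivalence (ModuleCat.restrictScalars.{w} ε.symm.toRingHom)
    (X := ModuleCat.of R M) hM) (ModuleCat.restrictScalarsIso ε e he)

theorem Module.Projective.of_semilinear (e : M ≃+ N) (he : ∀ r m, e (r • m) = ε r • e m)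
    (hM : Module.Projective R M) : Module.Projective S N := by
  have hM' : CategoryTheory.Projective (ModuleCat.of R M) := (IsProjective.iff_projective M).1 hM
  have := (ModuleCat.restrictScalars.{w} ε.symm.toRingHom).asEquivalence.toAdjunction.map_projective
    _ hM'
  exact (IsProjective.iff_projective N).2
    (CategoryTheory.Projective.of_iso (ModuleCat.restrictScalarsIso ε e he) this)

theorem Module.Projective.semilinear_iff (e : M ≃+ N) (he : ∀ r m, e (r • m) = ε r • e m) :
    Module.Projective R M ↔ Module.Projective S N :=
  ⟨Module.Projective.of_semilinear ε e he,
    Module.Projective.of_semilinear ε.symm e.symm fun s n => by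
      rw [e.symm_apply_eq, he, ε.apply_symm_apply, e.apply_symm_apply]⟩

end SemilinearTransfer

/-! ### Peirce decomposition, the corner ring and the equivalence -/

section ModFact

variable {A : Type u} [Ring A] {ω : A} {σ : A ≃+* A}

namespace TwistedMatrix

/-- The embedding of `A` as scalar matrices. -/
def scalar (h : IsNormalTwist ω σ) : A →+* TwistedMatrix h where
  toFun a := ⟨a, 0, 0, a⟩
  map_one' := rfl
  map_mul' a b := by simp [mul_def]
  map_zero' := rfl
  map_add' a b := by simp [add_def]

variable {h : IsNormalTwist ω σ} (M : ModuleCat.{w} (TwistedMatrix h))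

/-- The `A`-submodule `e M` of a module over `M₂(A; ω, σ)`, for an element `e` commuting with
scalar matrices. -/
def fixedPoints (e : TwistedMatrix h) (he : ∀ a, e * scalar h a = scalar h a * e) :
    Submodule A ((ModuleCat.restrictScalars.{w} (scalar h)).obj M) where
  carrier := {x | e • (show M from x) = x}
  add_mem' {x y} hx hy := by
    change e • ((show M from x) + (show M from y)) = (show M from x) + (show M from y)
    rw [smul_add]
    exact congrArg₂ (· + ·) hx hy
  zero_mem' := smul_zero (A := M) e
  smul_mem' a x hx := by
    change e • scalar h a • (show M from x) = scalar h a • (show M from x)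
    rw [smul_smul, he, mul_smul]
    exact congrArg (scalar h a • ·) hx

/-- The summand `e₁₁ M`. -/
def summand₁ : Submodule A ((ModuleCat.restrictScalars.{w} (scalar h)).obj M) :=
  fixedPoints M ⟨1, 0, 0, 0⟩ fun a => by simp [scalar, mul_def]

/-- The summand `e₂₂ M`. -/
def summand₀ : Submodule A ((ModuleCat.restrictScalars.{w} (scalar h)).obj M) :=
  fixedPoints M ⟨0, 0, 0, 1⟩ fun a => by simp [scalar, mul_def]

variable {M}

/-- On e₁₁M only the first column of a matrix acts. -/
theorem smul_eq_of_mem_summand₁ {x : M} (hx : (⟨1, 0, 0, 0⟩ : TwistedMatrix h) • x = x)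
    (a : TwistedMatrix h) :
    a • x = scalar h a.a₁₁ • x + scalar h a.a₂₁ • (⟨0, 0, 1, 0⟩ : TwistedMatrix h) • x := by
  conv_lhs => rw [← hx]
  conv_rhs => rw [← hx]
  simp only [smul_smul, ← add_smul]
  congr 1
  simp [scalar, mul_def, add_def]

theorem smul_eq_of_mem_summand₀ {x : M} (hx : (⟨0, 0, 0, 1⟩ : TwistedMatrix h) • x = x)
    (a : TwistedMatrix h) :
    a • x = scalar h a.a₁₂ • (⟨0, 1, 0, 0⟩ : TwistedMatrix h) • x + scalar h a.a₂₂ • x := by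
  conv_lhs => rw [← hx]
  conv_rhs => rw [← hx]
  simp only [smul_smul, ← add_smul]
  congr 1
  simp [scalar, mul_def, add_def]

variable (M)

/-- The module factorization `(e₂₂ M, e₁₁ M)` of a module `M` over `M₂(A; ω, σ)`. -/
noncomputable def toModFact : ModFact.{u, w} h :=
  ModFact.of h (ModuleCat.of A (summand₀ M)) (ModuleCat.of A (summand₁ M))
    { toFun := fun x => ⟨(⟨0, 1, 0, 0⟩ : TwistedMatrix h) • (show M from x.1), by
        change (⟨1, 0, 0, 0⟩ : TwistedMatrix h) • (⟨0, 1, 0, 0⟩ : TwistedMatrix h) •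
          (show M from x.1) = _
        rw [smul_smul]
        congr 1
        simp [mul_def]⟩
      map_add' := fun x y => Subtype.ext (smul_add _ (show M from x.1) (show M from y.1))
      map_smul' := fun a x => Subtype.ext (by
        change (⟨0, 1, 0, 0⟩ : TwistedMatrix h) • scalar h a • (show M from x.1) =
          scalar h a • (⟨0, 1, 0, 0⟩ : TwistedMatrix h) • (show M from x.1)
        rw [smul_smul, smul_smul]
        congr 1
        simp [mul_def, scalar]) }
    { toFun := fun x => ⟨(⟨0, 0, 1, 0⟩ : TwistedMatrix h) • (show M from x.1), by
        change (⟨0, 0, 0, 1⟩ : TwistedMatrix h) • (⟨0, 0, 1, 0⟩ : TwistedMatrix h) •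
          (show M from x.1) = _
        rw [smul_smul]
        congr 1
        simp [mul_def]⟩
      map_add' := fun x y => Subtype.ext (smul_add _ (show M from x.1) (show M from y.1))
      map_smul' := fun a x => Subtype.ext (by
        change (⟨0, 0, 1, 0⟩ : TwistedMatrix h) • scalar h a • (show M from x.1) =
          scalar h (σ a) • (⟨0, 0, 1, 0⟩ : TwistedMatrix h) • (show M from x.1)
        rw [smul_smul, smul_smul]
        congr 1
        simp [mul_def, scalar]) }
    (fun x => Subtype.ext (by
      have hx : (⟨0, 0, 0, 1⟩ : TwistedMatrix h) • (show M from x.1) = x.1 := x.2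
      change (⟨0, 0, 1, 0⟩ : TwistedMatrix h) • (⟨0, 1, 0, 0⟩ : TwistedMatrix h) •
        (show M from x.1) = scalar h ω • (show M from x.1)
      rw [← hx, smul_smul, smul_smul, smul_smul]
      congr 1
      simp [mul_def, scalar]))
    (fun x => Subtype.ext (by
      have hx : (⟨1, 0, 0, 0⟩ : TwistedMatrix h) • (show M from x.1) = x.1 := x.2
      change (⟨0, 1, 0, 0⟩ : TwistedMatrix h) • (⟨0, 0, 1, 0⟩ : TwistedMatrix h) •
        (show M from x.1) = scalar h ω • (show M from x.1)
      rw [← hx, smul_smul, smul_smul, smul_smul]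
      congr 1
      simp [mul_def, scalar]))

/-- The decomposition `M = e₁₁ M ⊕ e₂₂ M`. -/
noncomputable def totalToModFact : (toModFact M).Total →ₗ[TwistedMatrix h] M where
  toFun x := (show M from x.fst.1) + (show M from x.snd.1)
  map_add' x y := add_add_add_comm (show M from x.fst.1) _ _ _
  map_smul' a x := by
    change (scalar h a.a₁₁ • (show M from x.fst.1) + scalar h a.a₁₂ •
      (⟨0, 1, 0, 0⟩ : TwistedMatrix h) • (show M from x.snd.1)) + (scalar h a.a₂₁ •
      (⟨0, 0, 1, 0⟩ : TwistedMatrix h) • (show M from x.fst.1) + scalar h a.a₂₂ •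
      (show M from x.snd.1)) = a • ((show M from x.fst.1) + (show M from x.snd.1))
    refine Eq.trans ?_ ((smul_add _ _ _).trans (congrArg₂ (· + ·)
      (smul_eq_of_mem_summand₁ x.fst.2 a) (smul_eq_of_mem_summand₀ x.snd.2 a))).symm
    exact add_add_add_comm _ _ _ _

/-- The diagonal matrix units are orthogonal idempotents with sum 1. -/
theorem totalToModFact_bijective : Function.Bijective (totalToModFact M) := by
  constructor
  · refine (injective_iff_map_eq_zero (totalToModFact M)).2 fun x hx => ?_
    have key : ∀ y z : M, (⟨1, 0, 0, 0⟩ : TwistedMatrix h) • y = y →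
        (⟨0, 0, 0, 1⟩ : TwistedMatrix h) • z = z → y + z = 0 → y = 0 ∧ z = 0 := by
      intro y z hy hz hyz
      have hz' : (⟨1, 0, 0, 0⟩ : TwistedMatrix h) • z = 0 := by
        rw [← hz, smul_smul, show (⟨1, 0, 0, 0⟩ : TwistedMatrix h) * ⟨0, 0, 0, 1⟩ = 0 by
          simp [mul_def, zero_def], zero_smul]
      have hy' : y = 0 := by
        have := smul_add (⟨1, 0, 0, 0⟩ : TwistedMatrix h) y z
        rwa [hyz, smul_zero, hy, hz', add_zero, eq_comm] at this
      exact ⟨hy', by rwa [hy', zero_add] at hyz⟩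
    obtain ⟨h₁, h₀⟩ := key _ _ x.fst.2 x.snd.2 hx
    exact ModFact.Total.ext (Subtype.ext h₁) (Subtype.ext h₀)
  · intro m
    refine ⟨⟨⟨(⟨1, 0, 0, 0⟩ : TwistedMatrix h) • m, ?_⟩,
      ⟨(⟨0, 0, 0, 1⟩ : TwistedMatrix h) • m, ?_⟩⟩, ?_⟩
    · change (⟨1, 0, 0, 0⟩ : TwistedMatrix h) • (⟨1, 0, 0, 0⟩ : TwistedMatrix h) • m = _
      rw [smul_smul]
      simp [mul_def]
    · change (⟨0, 0, 0, 1⟩ : TwistedMatrix h) • (⟨0, 0, 0, 1⟩ : TwistedMatrix h) • m = _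
      rw [smul_smul]
      simp [mul_def]
    · change (⟨1, 0, 0, 0⟩ : TwistedMatrix h) • m + (⟨0, 0, 0, 1⟩ : TwistedMatrix h) • m = m
      rw [← add_smul, show (⟨1, 0, 0, 0⟩ : TwistedMatrix h) + ⟨0, 0, 0, 1⟩ = 1 by
        simp [add_def, one_def], one_smul]

/-- The ring isomorphism `A ≃ e₁₁ M₂(A; ω, σ) e₁₁`. -/
def cornerEquiv (h : IsNormalTwist ω σ) : A ≃+* (isIdempotentElem_e₁₁ h).Corner where
  toFun a := ⟨⟨a, 0, 0, 0⟩, (Subsemigroup.mem_corner_iff (isIdempotentElem_e₁₁ h)).2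
    ⟨by simp [e₁₁, mul_def], by simp [e₁₁, mul_def]⟩⟩
  invFun c := c.1.a₁₁
  left_inv a := rfl
  right_inv c := by
    obtain ⟨h₁, h₂⟩ := (Subsemigroup.mem_corner_iff (isIdempotentElem_e₁₁ h)).1 c.2
    refine Subtype.ext (TwistedMatrix.ext rfl ?_ ?_ ?_)
    · simpa [e₁₁, mul_def] using congrArg a₁₂ h₂
    · simpa [e₁₁, mul_def] using congrArg a₂₁ h₁
    · simpa [e₁₁, mul_def] using congrArg a₂₂ h₁
  map_mul' a b := Subtype.ext (by
    change _ = (⟨a, 0, 0, 0⟩ : TwistedMatrix h) * ⟨b, 0, 0, 0⟩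
    simp [mul_def])
  map_add' a b := Subtype.ext (by
    change _ = (⟨a, 0, 0, 0⟩ : TwistedMatrix h) + ⟨b, 0, 0, 0⟩
    simp [add_def])

/-- The first row of Γ is free of rank two over A ≅ e₁₁Γe₁₁. -/
theorem projective_schur_self (h : IsNormalTwist ω σ) :
    Module.Projective (isIdempotentElem_e₁₁ h).Corner
      (schur (isIdempotentElem_e₁₁ h) (TwistedMatrix h)) := by
  have hmem : ∀ a : A × A, e₁₁ h • (⟨a.1, a.2, 0, 0⟩ : TwistedMatrix h) = ⟨a.1, a.2, 0, 0⟩ :=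
    fun a => by simp [e₁₁, mul_def]
  refine Module.Projective.of_semilinear (cornerEquiv h) (M := A × A)
    { toFun := fun a => ⟨⟨a.1, a.2, 0, 0⟩, mem_schur_of_smul_eq _ (hmem a)⟩
      invFun := fun x => (x.1.a₁₁, x.1.a₁₂)
      left_inv := fun a => rfl
      right_inv := fun x => ?_
      map_add' := fun a b => Subtype.ext ?_ } (fun r a => Subtype.ext ?_) inferInstance
  · have hx := smul_eq_of_mem_schur _ x.2
    refine Subtype.ext (TwistedMatrix.ext rfl rfl ?_ ?_)
    · simpa [e₁₁, mul_def] using congrArg a₂₁ hx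
    · simpa [e₁₁, mul_def] using congrArg a₂₂ hx
  · change _ = (⟨a.1, a.2, 0, 0⟩ : TwistedMatrix h) + ⟨b.1, b.2, 0, 0⟩
    simp [add_def]
  · change _ = (⟨r, 0, 0, 0⟩ : TwistedMatrix h) * ⟨a.1, a.2, 0, 0⟩
    simp [mul_def]

end TwistedMatrix

open TwistedMatrix

variable {h : IsNormalTwist ω σ}

instance : (totalFunctor.{u, w} h).EssSurj where
  mem_essImage M := ⟨toModFact M,
    ⟨(LinearEquiv.ofBijective _ (totalToModFact_bijective M)).toModuleIso⟩⟩

instance : (totalFunctor.{u, w} h).IsEquivalence where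

instance : (totalFunctor.{u, w} h).inv.Additive :=
  have : (totalFunctor.{u, w} h).asEquivalence.functor.Additive :=
    inferInstanceAs (totalFunctor h).Additive
  (totalFunctor h).asEquivalence.inverse_additive

instance (σ : A ≃+* A) : (twist.{u, w} σ).IsEquivalence :=
  ModuleCat.restrictScalars_isEquivalence_of_ringEquiv σ

/-- Unwinds to σ(ω) = ω; needed for (V, σV; ω, 1) to be a factorization. -/
theorem twist_map_omegaTrans_app (h : IsNormalTwist ω σ) (V : ModuleCat.{w} A) :
    (twist.{u, w} σ).map ((omegaTrans h).app V) = (omegaTrans h).app ((twist.{u, w} σ).obj V) := by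
  ext x
  change ω • (show V from x) = σ ω • (show V from x)
  rw [h.map_eq]

/-- The components of a module over `M₂(A; ω, σ)` form a Frobenius pair. -/
noncomputable def frobeniusPair (h : IsNormalTwist ω σ) :
    FrobeniusPair.{u, u, w} (TwistedMatrix h) A where
  e₀ := (totalFunctor h).inv ⋙ Factorization.pr₀ _ _
  e₁ := (totalFunctor h).inv ⋙ Factorization.pr₁ _ _
  t₀ := Factorization.trivial₀ _ _ ⋙ totalFunctor h
  t₁ := Factorization.trivial₁ _ _ (twist_map_omegaTrans_app h) ⋙ totalFunctor h
  s := (twist σ).inv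
  isEquivalence_s := inferInstance
  full_t₀ := inferInstance
  faithful_t₀ := inferInstance
  full_t₁ := inferInstance
  faithful_t₁ := inferInstance
  adj₀₀ := (Factorization.trivial₀Adj _ _).comp (totalFunctor h).asEquivalence.toAdjunction
  adj₁₀ := (totalFunctor h).asEquivalence.symm.toAdjunction.comp (Factorization.pr₁Adj _ _)
  adj₀₁ := (totalFunctor h).asEquivalence.symm.toAdjunction.comp (Factorization.pr₀Adj _ _ _)
  adj₁₁ := (Factorization.trivial₁Adj _ _ (twist_map_omegaTrans_app h)).comp
    (totalFunctor h).asEquivalence.toAdjunction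
  additive_e₀ := inferInstance
  additive_e₁ := inferInstance
  jointly_faithful f h₀ h₁ := by
    apply (totalFunctor h).inv.map_injective
    rw [Functor.map_zero]
    exact Factorization.hom_ext h₀ h₁

/-- An instance of `FrobeniusPair.gProj_iff`, whose components involve the quasi-inverse; the unit
isomorphism removes it. -/
theorem gProj_total_iff [Small.{w} A] [Small.{w} (TwistedMatrix h)] (X : ModFact.{u, w} h) :
    GProj (TwistedMatrix h) ((totalFunctor h).obj X) ↔ GProj A X.obj₀ ∧ GProj A X.obj₁ := by
  have α := (totalFunctor h).asEquivalence.unitIso.app X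
  rw [(frobeniusPair h).gProj_iff]
  exact and_congr
    ((GProj A).prop_iff_of_iso ((Factorization.pr₀ _ _).mapIso α)).symm
    ((GProj A).prop_iff_of_iso ((Factorization.pr₁ _ _).mapIso α)).symm

theorem shortExact_total_iff (S : ShortComplex (ModFact.{u, w} h)) :
    (S.map (totalFunctor h)).ShortExact ↔
      (S.map (Factorization.pr₀ _ _)).ShortExact ∧ (S.map (Factorization.pr₁ _ _)).ShortExact := by
  refine (ModuleCat.shortExact_mk_iff _ _ _).trans (Iff.trans ?_
    (and_congr (ModuleCat.shortExact_mk_iff _ _ _) (ModuleCat.shortExact_mk_iff _ _ _)).symm)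
  constructor
  · rintro ⟨hi, hp, he⟩
    refine ⟨⟨fun x y hxy => ?_, fun y => ?_, fun y hy => ?_⟩,
      fun x y hxy => ?_, fun y => ?_, fun y hy => ?_⟩
    · exact congrArg ModFact.Total.snd (@hi ⟨0, x⟩ ⟨0, y⟩ (ModFact.Total.ext rfl hxy))
    · obtain ⟨x, hx⟩ := hp ⟨0, y⟩
      exact ⟨x.snd, congrArg ModFact.Total.snd hx⟩
    · obtain ⟨x, hx⟩ := he ⟨0, y⟩ (ModFact.Total.ext (map_zero S.g.f₁.hom) hy)
      exact ⟨x.snd, congrArg ModFact.Total.snd hx⟩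
    · exact congrArg ModFact.Total.fst (@hi ⟨x, 0⟩ ⟨y, 0⟩ (ModFact.Total.ext hxy rfl))
    · obtain ⟨x, hx⟩ := hp ⟨y, 0⟩
      exact ⟨x.fst, congrArg ModFact.Total.fst hx⟩
    · obtain ⟨x, hx⟩ := he ⟨y, 0⟩ (ModFact.Total.ext hy (map_zero S.g.f₀.hom))
      exact ⟨x.fst, congrArg ModFact.Total.fst hx⟩
  · rintro ⟨⟨hi₀, hp₀, he₀⟩, hi₁, hp₁, he₁⟩
    refine ⟨fun x y hxy => ?_, fun y => ?_, fun y hy => ?_⟩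
    · exact ModFact.Total.ext (hi₁ (congrArg ModFact.Total.fst hxy))
        (hi₀ (congrArg ModFact.Total.snd hxy))
    · obtain ⟨x₁, hx₁⟩ := hp₁ y.fst
      obtain ⟨x₀, hx₀⟩ := hp₀ y.snd
      exact ⟨⟨x₁, x₀⟩, ModFact.Total.ext hx₁ hx₀⟩
    · obtain ⟨x₁, hx₁⟩ := he₁ y.fst (congrArg ModFact.Total.fst hy)
      obtain ⟨x₀, hx₀⟩ := he₀ y.snd (congrArg ModFact.Total.snd hy)
      exact ⟨⟨x₁, x₀⟩, ModFact.Total.ext hx₁ hx₀⟩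

/-- The semilinear isomorphism `X¹ ≃ e₁₁ (X¹ × X⁰)`. -/
def schurTotalEquiv (X : ModFact.{u, w} h) :
    X.obj₁ ≃+ schur (isIdempotentElem_e₁₁ h) X.Total where
  toFun x := ⟨⟨x, 0⟩, mem_schur_of_smul_eq _ (by simp [e₁₁, ModFact.Total.smul_mk])⟩
  invFun y := y.1.fst
  left_inv x := rfl
  right_inv y := by
    have hy := congrArg ModFact.Total.snd (smul_eq_of_mem_schur _ y.2)
    refine Subtype.ext (ModFact.Total.ext rfl ?_)
    simpa [e₁₁] using hy
  map_add' x y := Subtype.ext (ModFact.Total.ext rfl (add_zero (0 : X.obj₀)).symm)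

theorem schurTotalEquiv_smul (X : ModFact.{u, w} h) (a : A) (x : X.obj₁) :
    schurTotalEquiv X (a • x) = cornerEquiv h a • schurTotalEquiv X x := by
  refine Subtype.ext ?_
  change _ = (⟨a, 0, 0, 0⟩ : TwistedMatrix h) • (⟨x, 0⟩ : X.Total)
  simp [ModFact.Total.smul_mk, schurTotalEquiv]

/-- Isomorphic modules have isomorphic Schur functors. -/
def schurCongr {R : Type u} [Ring R] {e : R} (he : IsIdempotentElem e) {M N : Type w}
    [AddCommGroup M] [Module R M] [AddCommGroup N] [Module R N] (α : M ≃ₗ[R] N) :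
    schur he M ≃ₗ[he.Corner] schur he N where
  toFun x := ⟨α x.1, mem_schur_of_smul_eq he (by
    rw [← map_smul, smul_eq_of_mem_schur he x.2])⟩
  invFun x := ⟨α.symm x.1, mem_schur_of_smul_eq he (by
    rw [← map_smul, smul_eq_of_mem_schur he x.2])⟩
  left_inv x := Subtype.ext (α.symm_apply_apply x.1)
  right_inv x := Subtype.ext (α.apply_symm_apply x.1)
  map_add' x y := Subtype.ext (map_add α x.1 y.1)
  map_smul' c x := Subtype.ext (map_smul α c.1 x.1)

end ModFact

/-! ### Exactness of equivalences that detect conflations -/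

section ExactStructures

namespace ExactStr

variable {C : Type*} [Category* C] [Preadditive C] {D : Type*} [Category* D] [Preadditive D]

instance (P : ObjectProperty C) (E : ObjectProperty (ShortComplex C))
    [E.IsClosedUnderIsomorphisms] : (restrict P E).IsClosedUnderIsomorphisms where
  of_iso α hS := E.prop_of_iso (P.ι.mapShortComplex.mapIso α) hS

instance (R : Type u) [Ring R] : (modules.{u, w} R).IsClosedUnderIsomorphisms where
  of_iso α hS := ShortComplex.shortExact_of_iso α hS

/-- An additive equivalence which preserves and detects conflations is exact, and so is its
quasi-inverse. -/
theorem isExactEquivalence_of_iff {E : ObjectProperty (ShortComplex C)}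
    {E' : ObjectProperty (ShortComplex D)} [E'.IsClosedUnderIsomorphisms] (F : C ≌ D)
    [hF : F.functor.Additive] (hE : ∀ S, E S ↔ E' (S.map F.functor)) :
    IsExactEquivalence E E' F := by
  refine ⟨⟨hF, fun S => (hE S).1⟩, ⟨F.inverse_additive, fun S hS => ?_⟩⟩
  have := F.inverse_additive
  rw [hE]
  exact E'.prop_of_iso (S.mapNatIso F.counitIso.symm) hS

end ExactStr

end ExactStructures

/-! ### Restriction to Gorenstein projectives and the main theorem -/

section MainResult

variable {A : Type u} [Ring A] {ω : A} {σ : A ≃+* A} (h : IsNormalTwist ω σ)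

open TwistedMatrix

instance : (GFact.inclusion.{u, w} h).Full where
  map_surjective f := ⟨⟨ObjectProperty.homMk f.f₀, ObjectProperty.homMk f.f₁,
    ObjectProperty.hom_ext _ f.comm₀, ObjectProperty.hom_ext _ f.comm₁⟩, rfl⟩

instance : (GFact.inclusion.{u, w} h).Faithful where
  map_injective hfg := Factorization.hom_ext
    (ObjectProperty.hom_ext _ (congrArg Factorization.Hom.f₀ hfg))
    (ObjectProperty.hom_ext _ (congrArg Factorization.Hom.f₁ hfg))

instance : (GFact.inclusion.{u, w} h).Additive where
  map_add := rfl

variable [Small.{w} A]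

/-- A projective cover with Gorenstein projective kernel is a conflation of A-GProj, so it splits
over a projective object. Conversely, deflations are epimorphisms of modules. -/
theorem isProjective_gProj_iff (X : (GProj.{u, w} A).FullSubcategory) :
    ExactStr.IsProjective (GProj.conflations A) X ↔ Module.Projective A X.obj := by
  constructor
  · intro hX
    obtain ⟨K, hK, P, i, p, hw, hS, hP, -⟩ := X.property.exists_syzygy
    let P' : (GProj.{u, w} A).FullSubcategory := ⟨P, GProj.of_projective P⟩
    let K' : (GProj.{u, w} A).FullSubcategory := ⟨K, hK⟩
    obtain ⟨s, hs⟩ := hX (ShortComplex.mk (X₁ := K') (X₂ := P') (X₃ := X)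
      (ObjectProperty.homMk i) (ObjectProperty.homMk p) (ObjectProperty.hom_ext _ hw)) hS (𝟙 X)
    have hPm := ModuleCat.projective_of_module_projective P
    refine Module.Projective.of_split s.hom.hom p.hom ?_
    ext x
    exact congrArg (fun k => k.hom.hom x) hs
  · intro hX S hS f
    have : Projective X.obj := (IsProjective.iff_projective _).1 hX
    have : Epi S.g.hom := hS.epi_g
    exact ⟨ObjectProperty.homMk (Projective.factorThru f.hom S.g.hom),
      ObjectProperty.hom_ext _ (Projective.factorThru_comp f.hom S.g.hom)⟩

variable [Small.{w} (TwistedMatrix h)]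

/-- The restriction of `totalFunctor` to Gorenstein projective modules. -/
noncomputable def gTotalFunctor :
    GFact.{u, w} h ⥤ (GProj.{u, w} (TwistedMatrix h)).FullSubcategory :=
  (GProj (TwistedMatrix h)).lift (GFact.inclusion h ⋙ totalFunctor h) fun X =>
    (gProj_total_iff _).2 ⟨X.obj₀.property, X.obj₁.property⟩

instance : (gTotalFunctor.{u, w} h).Full :=
  inferInstanceAs (ObjectProperty.lift _ _ _).Full

instance : (gTotalFunctor.{u, w} h).Faithful :=
  inferInstanceAs (ObjectProperty.lift _ _ _).Faithful

instance : (gTotalFunctor.{u, w} h).Additive where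
  map_add := rfl

instance : (gTotalFunctor.{u, w} h).EssSurj where
  mem_essImage Y := by
    let X := (totalFunctor h).objPreimage Y.obj
    let α : (totalFunctor h).obj X ≅ Y.obj := (totalFunctor h).objObjPreimageIso Y.obj
    obtain ⟨h₀, h₁⟩ := (gProj_total_iff X).1 ((GProj _).prop_of_iso α.symm Y.property)
    let G : GFact.{u, w} h :=
      { obj₀ := ⟨X.obj₀, h₀⟩
        obj₁ := ⟨X.obj₁, h₁⟩
        d₀ := ObjectProperty.homMk X.d₀
        d₁ := ObjectProperty.homMk X.d₁
        d₀_d₁ := ObjectProperty.hom_ext _ X.d₀_d₁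
        d₁_d₀ := ObjectProperty.hom_ext _ X.d₁_d₀ }
    exact ⟨G, ⟨(GProj _).ι.preimageIso (X := (gTotalFunctor h).obj G) α⟩⟩

instance : (gTotalFunctor.{u, w} h).IsEquivalence where

/-- The equivalence `GF(A; ω) ≌ M₂(A; ω, σ)-GProj`. -/
noncomputable def gTotalEquivalence :
    GFact.{u, w} h ≌ (GProj.{u, w} (TwistedMatrix h)).FullSubcategory :=
  (gTotalFunctor h).asEquivalence

instance : (gTotalEquivalence.{u, w} h).functor.Additive :=
  inferInstanceAs (gTotalFunctor h).Additive

instance : (GProj.conflations.{u, w} (TwistedMatrix h)).IsClosedUnderIsomorphisms :=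
  inferInstanceAs (ExactStr.restrict _ _).IsClosedUnderIsomorphisms

theorem conflations_iff (S : ShortComplex (GFact.{u, w} h)) :
    GFact.conflations h S ↔
      GProj.conflations (TwistedMatrix h) (S.map (gTotalEquivalence h).functor) :=
  (shortExact_total_iff (S.map (GFact.inclusion h))).symm

/-- e₁₁ cuts out X¹ from X¹ × X⁰, semilinearly over A ≅ e₁₁Γe₁₁. -/
theorem gFactZero_iff (X : GFact.{u, w} h)
    [Small.{w} (isIdempotentElem_e₁₁ h).Corner] :
    GProjIdem (isIdempotentElem_e₁₁ h) ((gTotalEquivalence h).functor.obj X) ↔ GFactZero h X :=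
  let X' := (GFact.inclusion h).obj X
  ((isProjective_gProj_iff X.obj₁).trans
    (Module.Projective.semilinear_iff (M := X'.obj₁) (N := schur (isIdempotentElem_e₁₁ h) X'.Total)
      (cornerEquiv h) (schurTotalEquiv X') (schurTotalEquiv_smul X'))).symm

theorem inverseImage_gProjIdem [Small.{w} (isIdempotentElem_e₁₁ h).Corner] :
    (GProjIdem.{u, w} (isIdempotentElem_e₁₁ h)).inverseImage (gTotalEquivalence h).functor =
      GFactZero h :=
  funext fun X => propext (gFactZero_iff h X)

instance {R : Type u} [Ring R] {e : R} (he : IsIdempotentElem e) :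
    (GProjIdem.{u, w} he).IsClosedUnderIsomorphisms where
  of_iso {X Y} α hX := by
    have hX' : Module.Projective he.Corner (schur he X.obj) := hX
    have β : X.obj ≅ Y.obj := (GProj R).ι.mapIso α
    exact Module.Projective.of_equiv' (schurCongr he β.toLinearEquiv)

end MainResult

theorem mainTheorem7 {A : Type u} [Ring A] (ω : A) (σ : A ≃+* A) (h : IsNormalTwist ω σ) :
    (∃ (Φ : ModFact.{u, max u v} h ≌ ModuleCat.{max u v} (TwistedMatrix h))
      (Φ₁ : GFact.{u, max u v} h ≌ (GProj.{u, max u v} (TwistedMatrix h)).FullSubcategory)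
      (Φ₂ : (GFactZero.{u, max u v} h).FullSubcategory ≌
        (GProjIdem.{u, max u v} (TwistedMatrix.isIdempotentElem_e₁₁ h)).FullSubcategory),
      -- `Φ₁` is a restriction of `Φ`, and an equivalence of exact categories
      Nonempty (Φ₁.functor ⋙ (GProj (TwistedMatrix h)).ι ≅ GFact.inclusion h ⋙ Φ.functor) ∧
      ExactStr.IsExactEquivalence (GFact.conflations h) (GProj.conflations (TwistedMatrix h)) Φ₁ ∧
      -- `Φ₂` is a restriction of `Φ₁`, and an equivalence of exact categories
      Nonempty (Φ₂.functor ⋙ (GProjIdem (TwistedMatrix.isIdempotentElem_e₁₁ h)).ι ≅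
        (GFactZero h).ι ⋙ Φ₁.functor) ∧
      ExactStr.IsExactEquivalence (ExactStr.restrict (GFactZero h) (GFact.conflations h))
        (ExactStr.restrict (GProjIdem (TwistedMatrix.isIdempotentElem_e₁₁ h))
          (GProj.conflations (TwistedMatrix h))) Φ₂) ∧
    IsGPCompatible.{u, max u v} (TwistedMatrix.isIdempotentElem_e₁₁ h) := by
  -- The restricted functors are lifts to full subcategories, so both compatibilities hold
  -- definitionally.
  refine ⟨⟨(totalFunctor h).asEquivalence, gTotalEquivalence h,
    (gTotalEquivalence h).congrFullSubcategory (inverseImage_gProjIdem h),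
    ⟨Iso.refl _⟩, ExactStr.isExactEquivalence_of_iff _ (conflations_iff h), ⟨Iso.refl _⟩, ?_⟩,
    TwistedMatrix.projective_schur_self h, fun G hG => ?_⟩
  · have : ((gTotalEquivalence.{u, max u v} h).congrFullSubcategory
        (inverseImage_gProjIdem h)).functor.Additive := ⟨rfl⟩
    exact ExactStr.isExactEquivalence_of_iff _ fun S =>
      conflations_iff h (S.map (GFactZero h).ι)
  -- Up to isomorphism `G` comes from a factorization `X`, and then e₁₁G is X¹, which is Gorenstein
  -- projective.
  · let X := (totalFunctor h).objPreimage G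
    let α : (totalFunctor h).obj X ≅ G := (totalFunctor h).objObjPreimageIso G
    have hX := (gProj_total_iff X).1 ((GProj _).prop_of_iso α.symm hG)
    have key : GProj (TwistedMatrix.isIdempotentElem_e₁₁ h).Corner (ModuleCat.of _
        (schur (TwistedMatrix.isIdempotentElem_e₁₁ h) X.Total)) :=
      IsGorensteinProjective.of_semilinear (TwistedMatrix.cornerEquiv h) (schurTotalEquiv X)
        (schurTotalEquiv_smul X) hX.2
    exact key.of_iso (schurCongr _ α.toLinearEquiv).toModuleIso
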